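/- A long knot diagram $K$ is given by an immersed $C^1$ curve $\gamma:\mathbb{R}\to\mathbb{R}^2$ with $\gamma(t)=(t,0)$ outside a compact set, whose only self-intersections are transverse double points (the crossings), together with a choice, at each crossing, of which of the two strands is the over strand. The curve is oriented by increasing $t$. The regions of $K$ are the connected components of $\mathbb{R}^2\setminus\gamma(\mathbb{R})$. Let $K$ have $n$ crossings, numbered $1,\dots,n$ in any order. For $1\le i\le n$ let $\sigma_i\in\{\pm1\}$ be the sign of crossing $i$ ($\sigma_i=+1$ exactly when (direction of the over strand, direction of the under strand) is a positively oriented basis of the plane). Let $d_i=+1$ if crossing $i$ is passed over before it is passed under, and $d_i=-1$ otherwise. Let $S(i)=\sigma_i d_i$, and let $X^{-S}$ be the diagonal matrix with entries $x^{-S(i)}$, where $x$ is an indeterminate. The span of crossing $i$ is the open segment of the knot between the two passages through crossing $i$. Let $T$ be the $n\times n$ matrix with $T_{ij}=1$ if the knot passes under crossing $j$ at some point of the span of crossing $i$, and $T_{ij}=0$ otherwise. Put $$\beta(K)(x)=\det\bigl(I+T(I-X^{-S})\bigr)\in\mathbb{Z}[x,x^{-1}].$$ Mark the four corners at each crossing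 as follows: going along the over strand in the direction of the orientation, the two corners on the right are marked $-x$ (before the under strand) and $x$ (after it), and the two corners on the left are marked $1$ (before) and $-1$ (after). **Theorem.** The diagram $K$ has exactly $n$ bounded regions. For every numbering of the bounded regions by $1,\dots,n$, let $A(K)$ be the $n\times n$ matrix whose $(i,j)$ entry is the sum of the markings of those corners of crossing $i$ that lie in the bounded region $j$ (and $0$ if there are none), and let $\Delta(K)(x)=\det A(K)\in\mathbb{Z}[x]$. Then $$\beta(K)(x)=x^{-l}\,\Delta(K)(x)\qquad\text{or}\qquad \beta(K)(x)=-x^{-l}\,\Delta(K)(x),$$ where $l$ is the number of crossings $j$ with $S(j)=+1$. -/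

import Mathlib

open scoped LaurentPolynomial Polynomial Topology

noncomputable section

/-- The underlying oriented plane curve of a long knot diagram (the plane is `ℂ`): a `C¹` immersion
of the line which is the standard inclusion outside a compact set, and whose only
self-intersections are transverse double points. -/
structure LongPlaneCurve where
  γ : ℝ → ℂ
  contDiff : ContDiff ℝ 1 γ
  immersion : ∀ t, deriv γ t ≠ 0
  standard_at_infinity : ∃ R : ℝ, ∀ t : ℝ, R ≤ |t| → γ t = (t : ℂ)
  no_triple_points : ∀ r s t : ℝ, r < s → s < t → ¬ (γ r = γ s ∧ γ s = γ t)
  transverse : ∀ s t : ℝ, s < t → γ s = γ t → LinearIndependent ℝ ![deriv γ s, deriv γ t]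

/-- A crossing, given by the two times `first < second` at which the curve passes through it. -/
structure LongPlaneCurve.Crossing (C : LongPlaneCurve) where
  first : ℝ
  second : ℝ
  first_lt_second : first < second
  double_point : C.γ first = C.γ second

/-- An oriented long knot diagram: such a plane curve, together with the information, at each
crossing, whether the strand of the first passage is the over strand. -/
structure LongKnotDiagram extends LongPlaneCurve where
  overFirst : toLongPlaneCurve.Crossing → Bool

namespace LongKnotDiagram

variable (K : LongKnotDiagram)

abbrev Crossing : Type := K.toLongPlaneCurve.Crossing

variable {K} in
/-- The time at which the over strand of a crossing is traversed. -/
def overTime (c : K.Crossing) : ℝ := if K.overFirst c then c.first else c.second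

variable {K} in
/-- The time at which the under strand of a crossing is traversed. -/
def underTime (c : K.Crossing) : ℝ := if K.overFirst c then c.second else c.first

variable {K} in
/-- Direction of the over strand at a crossing. -/
def overDir (c : K.Crossing) : ℂ := deriv K.γ (overTime c)

variable {K} in
/-- Direction of the under strand at a crossing. -/
def underDir (c : K.Crossing) : ℂ := deriv K.γ (underTime c)

variable {K} in
/-- The sign of a crossing: `+1` if (over direction, under direction) is a positively oriented
basis of the plane, i.e. the under strand goes from the right of the over strand to its left,
and `-1` otherwise. -/
def crossingSign (c : K.Crossing) : ℤ :=
  if 0 < (overDir c).re * (underDir c).im - (overDir c).im * (underDir c).re then 1 else -1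

variable {K} in
/-- `+1` if the crossing is first passed over and then under, `-1` otherwise. -/
def direction (c : K.Crossing) : ℤ := if K.overFirst c then 1 else -1

variable {K} in
/-- `S = σ d`. -/
def S (c : K.Crossing) : ℤ := crossingSign c * direction c

variable {K} in
/-- The times during which the span of a crossing is traversed. -/
def spanTimes (c : K.Crossing) : Set ℝ := Set.Ioo c.first c.second

/-- The plane minus the diagram. -/
def complement : Set ℂ := (Set.range K.γ)ᶜ

/-- The regions of the diagram: the connected components of the complement of the curve. -/
def IsRegion (U : Set ℂ) : Prop :=
  ∃ z ∈ K.complement, U = connectedComponentIn K.complement z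

/-- The bounded regions. -/
def BoundedRegion : Type := {U : Set ℂ // K.IsRegion U ∧ Bornology.IsBounded U}

variable {K} in
/-- The corner `(a, b)` of a crossing is the local quadrant, cut out by the two strands, into which
the vector `a • (over direction) + b • (under direction)` points. It lies in `U` if all points
sufficiently close to the crossing in the direction of this vector do. -/
def CornerIn (c : K.Crossing) (a b : ℤˣ) (U : Set ℂ) : Prop :=
  ∀ᶠ δ : ℝ in 𝓝[>] 0,
    K.γ c.first + (δ : ℂ) * (((a : ℤ) : ℂ) * overDir c + ((b : ℤ) : ℂ) * underDir c) ∈ U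

variable {K} in
/-- The marking of the corner `(a, b)`. Moving along the over strand, the corner comes before the
under strand if `a = -1` and after it if `a = 1`; it is on the left of the over strand if
`b` equals the sign of the crossing, and on the right otherwise. The markings on the right are
`-X`, then `X`; those on the left are `1`, then `-1`. -/
def marking (c : K.Crossing) (a b : ℤˣ) : ℤ[X] :=
  if (b : ℤ) = crossingSign c then -(((a : ℤ) : ℤ[X])) else ((a : ℤ) : ℤ[X]) * Polynomial.X

variable {n : ℕ}

open Classical in
/-- Alexander's matrix, with respect to numberings of the crossings and of the bounded regions:
the `(i, j)` entry collects the markings at crossing `i` which lie in region `j`. -/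
def alexanderMatrix (c : Fin n ≃ K.Crossing) (r : Fin n ≃ K.BoundedRegion) :
    Matrix (Fin n) (Fin n) ℤ[X] :=
  Matrix.of fun i j => ∑ a : ℤˣ, ∑ b : ℤˣ,
    if CornerIn (c i) a b (r j).1 then marking (c i) a b else 0

/-- `Δ(K)`. -/
def alexanderDet (c : Fin n ≃ K.Crossing) (r : Fin n ≃ K.BoundedRegion) : ℤ[X] :=
  (K.alexanderMatrix c r).det

open Classical in
/-- The matrix `T`: the `(i, j)` entry is `1` if the under strand of crossing `j` is traversed
during the span of crossing `i`, and `0` otherwise. -/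
def trappingMatrix (c : Fin n ≃ K.Crossing) : Matrix (Fin n) (Fin n) ℤ[T;T⁻¹] :=
  Matrix.of fun i j => if underTime (c j) ∈ spanTimes (c i) then 1 else 0

/-- The diagonal matrix `X^{-S}`. -/
def xPowNegS (c : Fin n ≃ K.Crossing) : Matrix (Fin n) (Fin n) ℤ[T;T⁻¹] :=
  Matrix.diagonal fun i => LaurentPolynomial.T (-S (c i))

/-- `β(K) = det (I + T (I - X^{-S}))`. -/
def beta (c : Fin n ≃ K.Crossing) : ℤ[T;T⁻¹] :=
  (1 + K.trappingMatrix c * (1 - K.xPowNegS c)).det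

/-- The number `l` of crossings with `S = +1`. -/
def numPositiveS : ℕ := Nat.card {c : K.Crossing // S c = 1}

end LongKnotDiagram

end

/-!
The complement `D` of the curve is open and dense, and its locally constant integer functions are
governed by their jumps across the curve. Near a crossing such a function has four values, one in
each quadrant (`LongPlaneCurve.Crossing.exists_quadrantValues`), so that its jumps along the four
half strands satisfy Kirchhoff's law. Conversely, jumps which satisfy this law can be realised near
every point, two local solutions differ by a constant (`eventually_const_of_jump_zero`), and since
`H¹(ℂ, ℤ) = 0` (`exists_global_of_local`) there is a global solution (`exists_locConst_of_jumps`).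

The span of a crossing `k` is a closed loop. Its index, i.e. its winding number as a function `w k`
on `D`, is obtained in this way: it vanishes far away and jumps by one across the span
(`LongPlaneCurve.Crossing.exists_isLoopIndex`). If `f` is locally constant on `D` and vanishes far
away, subtract the combination of the `w k` whose coefficients are the changes of the jump of `f` at
the first passages. The jump of the difference never changes along the curve, so it is zero, and the
difference vanishes: the `w k` form a basis of these functions
(`LongPlaneCurve.LocConst.exists_combination`, `eq_zero_of_combination_eq_zero`). The
indicator functions of the bounded regions form another one. Hence there are as many bounded regions
as crossings, and the matrix `W` of the indices of the loops around the regions has determinant `±1` (`LongKnotDiagram.isUnit_det_indexMatrix`).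

The product of Alexander's matrix with `W` is computed locally at each crossing
(`sum_marking_cornerValue`): only the jump across the under strand contributes, together with a
diagonal term because the loop of a crossing turns a corner there. Up to row factors `±x`, for
`S = 1`, and `±1`, for `S = -1`, the product is the transpose of `I + T (I - X^{-S})`. Taking
determinants yields the theorem.
-/

/-! ### Gluing locally constant functions -/

/-- If near each point of a preconnected set a function is constant on the dense set `D`, the
constants agree: they depend continuously on the point. -/
theorem exists_const_of_eventually_const {X Y : Type*} [TopologicalSpace X] {D O : Set X}
    (hD : Dense D) (hO : IsPreconnected O) (hne : O.Nonempty) {F : X → Y}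
    (h : ∀ p ∈ O, ∃ c, ∀ᶠ z in 𝓝 p, z ∈ D → F z = c) :
    ∃ c, ∀ p ∈ O, ∀ᶠ z in 𝓝 p, z ∈ D → F z = c := by
  classical
  obtain ⟨o, ho⟩ := hne
  obtain ⟨c₀, -⟩ := h o ho
  let c : X → Y := fun p => if hp : p ∈ O then (h p hp).choose else c₀
  have hc : ∀ p ∈ O, ∀ᶠ z in 𝓝 p, z ∈ D → F z = c p := fun p hp => by
    simpa only [c, dif_pos hp] using (h p hp).choose_spec
  let _ : TopologicalSpace Y := ⊥
  have : DiscreteTopology Y := ⟨rfl⟩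
  have hcont : ContinuousOn c O := by
    intro p hp
    have : ∀ᶠ q in 𝓝[O] p, c q = c p := by
      filter_upwards [nhdsWithin_le_nhds (hc p hp).eventually_nhds, self_mem_nhdsWithin]
        with q hq hqO
      obtain ⟨z, hz, hzD⟩ := ((hc q hqO).and hq).and_frequently
        (mem_closure_iff_frequently.1 (hD q)) |>.exists
      rw [← hz.1 hzD, hz.2 hzD]
    exact (tendsto_nhds_of_eventually_eq this)
  refine ⟨c o, fun p hp => ?_⟩
  rw [hO.constant hcont ho hp]
  exact hc p hp

/-- The first cohomology of the plane with integer coefficients vanishes: local integer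
functions on a dense set `D`, one near each point and any two of them differing by a local constant,
come from one global function. -/
theorem exists_global_of_local {D : Set ℂ} (hD : Dense D) (m : ℂ → ℂ → ℤ)
    (hm : ∀ p, ∀ᶠ q in 𝓝 p, ∃ c : ℤ, ∀ᶠ z in 𝓝 q, z ∈ D → m p z - m q z = c) :
    ∃ F : ℂ → ℤ, ∀ p, ∃ c : ℤ, ∀ᶠ z in 𝓝 p, z ∈ D → F z - m p z = c := by
  have hU : ∀ p, ∃ U : Set ℂ, p ∈ U ∧ IsOpen U ∧
      ∀ q ∈ U, ∃ c : ℤ, ∀ᶠ z in 𝓝 q, z ∈ D → m p z - m q z = c := fun p => by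
    obtain ⟨U, h1, h2, h3⟩ := eventually_nhds_iff.1 (hm p)
    exact ⟨U, h3, h2, h1⟩
  choose U hpU hUo hUc using hU
  obtain ⟨ρ, hρ⟩ := PartitionOfUnity.exists_isSubordinate (s := (Set.univ : Set ℂ)) isClosed_univ U
    hUo (fun p _ => Set.mem_iUnion.2 ⟨p, hpU p⟩)
  -- The average of the local functions differs from each of them by a continuous function.
  let φ : ℂ → ℝ := fun z => ∑ᶠ p, ρ p z • (m p z : ℝ)
  have hφ : ∀ q, ∃ h : ℂ → ℝ, Continuous h ∧ ∀ᶠ z in 𝓝 q, z ∈ D → φ z = m q z + h z := by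
    intro q
    have hc : ∀ p, ∃ c : ℤ, p ∈ ρ.fintsupport q → ∀ᶠ z in 𝓝 q, z ∈ D → m p z - m q z = c := by
      intro p
      by_cases hp : p ∈ ρ.fintsupport q
      · obtain ⟨c, hc⟩ := hUc p q (hρ p ((ρ.mem_fintsupport_iff q p).1 hp))
        exact ⟨c, fun _ => hc⟩
      · exact ⟨0, fun h => (hp h).elim⟩
    choose c hc using hc
    refine ⟨fun z => ∑ p ∈ ρ.fintsupport q, ρ p z * c p, by fun_prop, ?_⟩
    have hall : ∀ᶠ z in 𝓝 q, ∀ p ∈ ρ.fintsupport q, z ∈ D → m p z - m q z = c p :=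
      (Filter.eventually_all_finset _).2 hc
    filter_upwards [hall, ρ.eventually_finsupport_subset q] with z hz hsub hzD
    have hone := ρ.sum_finsupport' (Set.mem_univ z) hsub
    have : φ z = ∑ p ∈ ρ.fintsupport q, ρ p z * m p z := by
      refine finsum_eq_sum_of_support_subset _ fun p hp => ?_
      refine hsub ((ρ.mem_finsupport z).2 ?_)
      intro h0
      exact hp (by simp [h0])
    rw [this, ← one_mul (m q z : ℝ), ← hone, Finset.sum_mul, ← Finset.sum_add_distrib]
    refine Finset.sum_congr rfl fun p hp => ?_
    have := hz p hp hzD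
    have h2 : (m p z : ℝ) - m q z = c p := by exact_mod_cast this
    rw [← h2]; ring
  choose h hcont hh using hφ
  have hint : ∀ k : ℤ, ((k : ℝ) : AddCircle (1 : ℝ)) = 0 := fun k => by
    rw [AddCircle.coe_eq_zero_iff]; exact ⟨k, by simp⟩
  -- Modulo `1` the average extends continuously to the plane, and so lifts to a real function.
  let f : ℂ → AddCircle (1 : ℝ) := fun z => (φ z : AddCircle (1 : ℝ))
  have hlim : ∀ q, Filter.Tendsto f (𝓝[D] q) (𝓝 ((h q q : ℝ) : AddCircle (1 : ℝ))) := by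
    intro q
    have h1 : Filter.Tendsto (fun z => ((h q z : ℝ) : AddCircle (1 : ℝ))) (𝓝[D] q)
        (𝓝 ((h q q : ℝ) : AddCircle (1 : ℝ))) :=
      (((AddCircle.continuous_mk' 1).comp (hcont q)).tendsto q).mono_left nhdsWithin_le_nhds
    refine h1.congr' ?_
    filter_upwards [nhdsWithin_le_nhds (hh q), self_mem_nhdsWithin] with z hz hzD
    simp only [f]
    rw [hz hzD, AddCircle.coe_add, hint, zero_add]
  have hG : Continuous (extendFrom D f) := continuous_extendFrom hD fun q => ⟨_, hlim q⟩
  have hGv : ∀ q, extendFrom D f q = ((h q q : ℝ) : AddCircle (1 : ℝ)) := fun q =>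
    extendFrom_eq (hD q) (hlim q)
  obtain ⟨ψ, ⟨-, hψ⟩, -⟩ := (AddCircle.isCoveringMap_coe (1 : ℝ)).existsUnique_continuousMap_lifts
    ⟨extendFrom D f, hG⟩ (a₀ := 0) (e₀ := h 0 0) (hGv 0).symm
  have hψ' : ∀ z, ((ψ z : ℝ) : AddCircle (1 : ℝ)) = extendFrom D f z := fun z => congrFun hψ z
  have hψint : ∀ z ∈ D, ∃ k : ℤ, φ z - ψ z = k := by
    intro z hz
    have h1 : ((φ z - ψ z : ℝ) : AddCircle (1 : ℝ)) = 0 := by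
      have := (hh z).self_of_nhds hz
      rw [AddCircle.coe_sub, hψ', hGv, this, AddCircle.coe_add, hint, zero_add, sub_self]
    obtain ⟨k, hk⟩ := (AddCircle.coe_eq_zero_iff (1 : ℝ)).1 h1
    exact ⟨k, by simpa using hk.symm⟩
  -- The difference of the average and the lift is an integer on `D`, and continuous up to the
  -- addition of one of the local functions; the rounding makes it an integer
  -- function defined everywhere.
  refine ⟨fun z => round (φ z - ψ z), fun q => ⟨round (h q q - ψ q), ?_⟩⟩
  have hv : ∃ k : ℤ, h q q - ψ q = k := by
    have h1 : ((h q q - ψ q : ℝ) : AddCircle (1 : ℝ)) = 0 := by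
      rw [AddCircle.coe_sub, hψ', hGv, sub_self]
    obtain ⟨k, hk⟩ := (AddCircle.coe_eq_zero_iff (1 : ℝ)).1 h1
    exact ⟨k, by simpa using hk.symm⟩
  obtain ⟨k, hk⟩ := hv
  have hnear : ∀ᶠ z in 𝓝 q, |(h q z - ψ z) - (h q q - ψ q)| < 1 :=
    (Metric.continuous_iff'.1 ((hcont q).sub ψ.continuous) q 1 one_pos)
  filter_upwards [hnear, hh q] with z hz1 hz2 hzD
  obtain ⟨l, hl⟩ := hψint z hzD
  have e1 : h q z - ψ z = ((l - m q z : ℤ) : ℝ) := by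
    push_cast; rw [← hl, hz2 hzD]; ring
  rw [e1, hk, ← Int.cast_sub, ← Int.cast_abs, ← Int.cast_one, Int.cast_lt, Int.abs_lt_one_iff]
    at hz1
  simp only [hl, hk, round_intCast]
  omega

/-- The complement of a closed disc in the plane is connected, being the image of a half plane
under the exponential map. -/
theorem isPreconnected_norm_gt {R : ℝ} (hR : 0 < R) : IsPreconnected {z : ℂ | R < ‖z‖} := by
  have : {z : ℂ | R < ‖z‖} = Complex.exp '' {z : ℂ | Real.log R < z.re} := by
    ext z
    constructor
    · intro hz
      have hz' : R < ‖z‖ := hz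
      have h0 : z ≠ 0 := by rintro rfl; simp at hz'; linarith
      refine ⟨Complex.log z, ?_, Complex.exp_log h0⟩
      simp only [Set.mem_ofPred_eq, Complex.log_re]
      exact Real.log_lt_log hR hz
    · rintro ⟨w, hw, rfl⟩
      simp only [Set.mem_ofPred_eq, Complex.norm_exp] at hw ⊢
      rwa [← Real.log_lt_iff_lt_exp hR]
  rw [this]
  exact ((convex_halfSpace_re_gt _).isPreconnected).image _ Complex.continuous_exp.continuousOn

/-! ### Straightening two transverse strands -/

/-- The determinant of two plane vectors. -/
def cross (v w : ℂ) : ℝ := v.re * w.im - v.im * w.re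

theorem cross_swap (v w : ℂ) : cross w v = -cross v w := by simp only [cross]; ring

theorem cross_self_I_mul (v : ℂ) : cross v (Complex.I * v) = ‖v‖ ^ 2 := by
  rw [← Complex.normSq_eq_norm_sq, Complex.normSq_apply]
  simp [cross]

theorem cross_ne_zero_of_linearIndependent {v w : ℂ} (h : LinearIndependent ℝ ![v, w]) :
    cross v w ≠ 0 := by
  intro h0
  have hv : v ≠ 0 := by simpa using h.ne_zero 0
  rw [LinearIndependent.pair_iff] at h
  simp only [cross] at h0
  by_cases hr : v.re = 0
  · have hi : v.im ≠ 0 := fun hi => hv (Complex.ext hr hi)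
    have := h w.im (-v.im) (by
      apply Complex.ext
      · simp; linarith
      · simp; ring)
    exact hi (by simpa using this.2)
  · have := h w.re (-v.re) (by
      apply Complex.ext
      · simp; ring
      · simp; linarith)
    exact hr (by simpa using this.2)

/-- Cramer's rule in the plane. -/
theorem cross_smul_eq (v w z : ℂ) :
    (cross v w : ℂ) * z = (cross z w : ℂ) * v + (cross v z : ℂ) * w := by
  apply Complex.ext <;> simp [cross] <;> ring

/-- Local coordinates `x, y` around a point `p` where two curves `α` and `β` meet with velocities
`v` and `w`. The point with coordinates `(s, u)` is `α s + β u - p`, so that `α` is the axis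
`y = u₀` and `β` is the axis `x = s₀`. -/
structure Straightening (α β : ℝ → ℂ) (s₀ u₀ : ℝ) (p v w : ℂ) where
  x : ℂ → ℝ
  y : ℂ → ℝ
  Lx : ℂ →L[ℝ] ℝ
  Ly : ℂ →L[ℝ] ℝ
  hx : HasStrictFDerivAt x Lx p
  hy : HasStrictFDerivAt y Ly p
  Lx_v : Lx v = 1
  Lx_w : Lx w = 0
  Ly_v : Ly v = 0
  Ly_w : Ly w = 1
  left_inv : ∀ᶠ z in 𝓝 p, α (x z) + β (y z) - p = z
  right_inv : ∀ᶠ q in 𝓝 (s₀, u₀), x (α q.1 + β q.2 - p) = q.1 ∧ y (α q.1 + β q.2 - p) = q.2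
  left_eq : α s₀ = p
  right_eq : β u₀ = p

namespace Straightening

theorem nonempty {α β : ℝ → ℂ} {s₀ u₀ : ℝ} {p v w : ℂ} (hα : HasStrictDerivAt α v s₀)
    (hβ : HasStrictDerivAt β w u₀) (hvw : cross v w ≠ 0) (hs : α s₀ = p) (hu : β u₀ = p) :
    Nonempty (Straightening α β s₀ u₀ p v w) := by
  -- The coordinates are the components of the local inverse of `(s, u) ↦ α s + β u - p`.
  let Φ : ℝ × ℝ → ℂ := fun q => α q.1 + β q.2 - p
  let L : ℝ × ℝ →L[ℝ] ℂ :=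
    (ContinuousLinearMap.fst ℝ ℝ ℝ).smulRight v + (ContinuousLinearMap.snd ℝ ℝ ℝ).smulRight w
  have hL : ∀ q, L q = (q.1 : ℂ) * v + (q.2 : ℂ) * w := fun q => by simp [L]
  let M : ℂ →ₗ[ℝ] ℝ × ℝ :=
    { toFun := fun z => (cross z w / cross v w, cross v z / cross v w)
      map_add' := fun a b => by
        ext <;> simp [cross] <;> ring
      map_smul' := fun r a => by
        ext <;> simp [cross] <;> ring }
  have hML : ∀ q, M (L q) = q := by
    intro q
    have h := hvw
    rw [hL]
    ext
    · simp only [M, LinearMap.coe_mk, AddHom.coe_mk]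
      field_simp
      simp [cross]; ring
    · simp only [M, LinearMap.coe_mk, AddHom.coe_mk]
      field_simp
      simp [cross]; ring
  have hLM : ∀ z, L (M z) = z := by
    intro z
    have h : (cross v w : ℂ) ≠ 0 := by exact_mod_cast hvw
    rw [hL]
    simp only [M, LinearMap.coe_mk, AddHom.coe_mk, Complex.ofReal_div]
    field_simp
    rw [← cross_smul_eq]
  let e : (ℝ × ℝ) ≃L[ℝ] ℂ := (LinearEquiv.ofLinearMap L.toLinearMap M
    (LinearMap.ext hLM) (LinearMap.ext hML)).toContinuousLinearEquiv
  have he : (e : ℝ × ℝ →L[ℝ] ℂ) = L := by ext <;> rfl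
  have hes : ∀ z, e.symm z = M z := fun z => rfl
  have hΦ : HasStrictFDerivAt Φ (e : ℝ × ℝ →L[ℝ] ℂ) (s₀, u₀) := by
    rw [he]
    have h1 : HasStrictFDerivAt (fun q : ℝ × ℝ => α q.1)
        ((ContinuousLinearMap.fst ℝ ℝ ℝ).smulRight v) (s₀, u₀) := by
      have := HasStrictFDerivAt.comp (s₀, u₀) (g := α) (f := Prod.fst)
        hα.hasStrictFDerivAt hasStrictFDerivAt_fst
      refine this.congr_fderiv ?_
      ext <;> simp
    have h2 : HasStrictFDerivAt (fun q : ℝ × ℝ => β q.2)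
        ((ContinuousLinearMap.snd ℝ ℝ ℝ).smulRight w) (s₀, u₀) := by
      have := HasStrictFDerivAt.comp (s₀, u₀) (g := β) (f := Prod.snd)
        hβ.hasStrictFDerivAt hasStrictFDerivAt_snd
      refine this.congr_fderiv ?_
      ext <;> simp
    exact (h1.add h2).sub_const p
  have hp : Φ (s₀, u₀) = p := by simp [Φ, hs, hu]
  let ψ := hΦ.localInverse
  have hψ : HasStrictFDerivAt ψ (e.symm : ℂ →L[ℝ] ℝ × ℝ) p := by
    have := hΦ.to_localInverse
    rwa [hp] at this
  have hMv : M v = (1, 0) := by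
    have := hML (1, 0); rwa [hL, Complex.ofReal_one, Complex.ofReal_zero, one_mul, zero_mul,
      add_zero] at this
  have hMw : M w = (0, 1) := by
    have := hML (0, 1); rwa [hL, Complex.ofReal_one, Complex.ofReal_zero, one_mul, zero_mul,
      zero_add] at this
  refine ⟨{
    x := fun z => (ψ z).1
    y := fun z => (ψ z).2
    Lx := (ContinuousLinearMap.fst ℝ ℝ ℝ).comp (e.symm : ℂ →L[ℝ] ℝ × ℝ)
    Ly := (ContinuousLinearMap.snd ℝ ℝ ℝ).comp (e.symm : ℂ →L[ℝ] ℝ × ℝ)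
    hx := hψ.fst
    hy := hψ.snd
    Lx_v := by simp [hes, hMv]
    Lx_w := by simp [hes, hMw]
    Ly_v := by simp [hes, hMv]
    Ly_w := by simp [hes, hMw]
    left_inv := ?_
    right_inv := ?_
    left_eq := hs
    right_eq := hu }⟩
  · have := hΦ.eventually_right_inverse
    rwa [hp] at this
  · filter_upwards [hΦ.eventually_left_inverse] with q hq
    change (ψ (Φ q)).1 = _ ∧ (ψ (Φ q)).2 = _
    rw [show ψ (Φ q) = q from hq]
    exact ⟨rfl, rfl⟩

variable {α β : ℝ → ℂ} {s₀ u₀ : ℝ} {p v w : ℂ}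

/-- The same coordinates with the roles of the two curves exchanged. -/
def swap (e : Straightening α β s₀ u₀ p v w) : Straightening β α u₀ s₀ p w v where
  x := e.y
  y := e.x
  Lx := e.Ly
  Ly := e.Lx
  hx := e.hy
  hy := e.hx
  Lx_v := e.Ly_w
  Lx_w := e.Ly_v
  Ly_v := e.Lx_w
  Ly_w := e.Lx_v
  left_inv := by filter_upwards [e.left_inv] with z hz; rw [add_comm, hz]
  right_inv := by
    have h : Filter.Tendsto Prod.swap (𝓝 (u₀, s₀)) (𝓝 (s₀, u₀)) := continuous_swap.tendsto _
    filter_upwards [h.eventually e.right_inv] with q hq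
    rw [add_comm (β q.1)]
    exact ⟨hq.2, hq.1⟩
  left_eq := e.right_eq
  right_eq := e.left_eq

variable (e : Straightening α β s₀ u₀ p v w)

theorem right_inv_left : ∀ᶠ s in 𝓝 s₀, e.x (α s) = s ∧ e.y (α s) = u₀ := by
  have h : Filter.Tendsto (fun s : ℝ => (s, u₀)) (𝓝 s₀) (𝓝 (s₀, u₀)) :=
    Continuous.tendsto (by fun_prop) _
  filter_upwards [h.eventually e.right_inv] with s hs
  simpa [e.right_eq] using hs

theorem x_p : e.x p = s₀ := by
  have := e.right_inv_left.self_of_nhds.1; rwa [e.left_eq] at this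

theorem y_p : e.y p = u₀ := by
  have := e.right_inv_left.self_of_nhds.2; rwa [e.left_eq] at this

theorem tendsto_x : Filter.Tendsto e.x (𝓝 p) (𝓝 s₀) := by
  simpa only [e.x_p] using e.hx.continuousAt.tendsto

theorem tendsto_y : Filter.Tendsto e.y (𝓝 p) (𝓝 u₀) := by
  simpa only [e.y_p] using e.hy.continuousAt.tendsto

theorem eventually_continuousAt_x : ∀ᶠ z in 𝓝 p, ContinuousAt e.x z := by
  obtain ⟨K, s, hs, hK⟩ := e.hx.exists_lipschitzOnWith
  filter_upwards [eventually_mem_nhds_iff.2 hs] with z hz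
  exact hK.continuousOn.continuousAt hz

theorem eventually_continuousAt_y : ∀ᶠ z in 𝓝 p, ContinuousAt e.y z :=
  e.swap.eventually_continuousAt_x

theorem Ly_I_mul (hvw : cross v w ≠ 0) : e.Ly (Complex.I * v) = ‖v‖ ^ 2 / cross v w := by
  have h := congrArg e.Ly (show (cross v w) • (Complex.I * v) =
      (cross (Complex.I * v) w) • v + (cross v (Complex.I * v)) • w by
    simp only [Complex.real_smul]; exact cross_smul_eq _ _ _)
  rw [map_smul, map_add, map_smul, map_smul, e.Ly_v, e.Ly_w, cross_self_I_mul] at h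
  simp only [smul_eq_mul, mul_zero, mul_one, zero_add] at h
  rw [eq_div_iff hvw, mul_comm, h]

/-- A function which is locally constant on a coordinate box has only one value near `p` there. -/
theorem exists_const_of_convex {Y : Type*} (hα : Continuous α) (hβ : Continuous β) {I J : Set ℝ}
    (hI : Convex ℝ I) (hJ : Convex ℝ J) {g : ℂ → Y}
    (hg : ∀ᶠ z in 𝓝 p, e.x z ∈ I → e.y z ∈ J → ∀ᶠ z' in 𝓝 z, g z' = g z) :
    ∃ k, ∀ᶠ z in 𝓝 p, e.x z ∈ I → e.y z ∈ J → g z = k := by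
  let Φ : ℝ × ℝ → ℂ := fun q => α q.1 + β q.2 - p
  have hΦ : Continuous Φ := by fun_prop
  have hΦp : Filter.Tendsto Φ (𝓝 (s₀, u₀)) (𝓝 p) := by
    have := hΦ.tendsto (s₀, u₀)
    simpa [Φ, e.left_eq, e.right_eq] using this
  obtain ⟨ε, hε, hball⟩ := Metric.eventually_nhds_iff_ball.1 ((hΦp.eventually hg).and e.right_inv)
  have hz : ∀ᶠ z in 𝓝 p, (e.x z, e.y z) ∈ Metric.ball (s₀, u₀) ε :=
    (e.tendsto_x.prodMk_nhds e.tendsto_y).eventually (Metric.ball_mem_nhds _ hε)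
  let Q : Set ℂ := Φ '' (Metric.ball (s₀, u₀) ε ∩ I ×ˢ J)
  have hQ : IsPreconnected Q :=
    (((convex_ball _ _).inter (hI.prod hJ)).isPreconnected).image _ hΦ.continuousOn
  have hmem : ∀ᶠ z in 𝓝 p, e.x z ∈ I → e.y z ∈ J → z ∈ Q := by
    filter_upwards [hz, e.left_inv] with z h1 h2 hx hy
    exact ⟨(e.x z, e.y z), ⟨h1, hx, hy⟩, h2⟩
  rcases Q.eq_empty_or_nonempty with h0 | hne
  · refine ⟨g p, ?_⟩
    filter_upwards [hmem] with z hz hx hy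
    exact absurd (hz hx hy) (by simp [h0])
  · obtain ⟨k, hk⟩ := exists_const_of_eventually_const (D := Set.univ) (F := g) dense_univ hQ hne
      (by
        rintro _ ⟨q, ⟨hq, hqI, hqJ⟩, rfl⟩
        obtain ⟨h1, h2⟩ := hball q hq
        refine ⟨g (Φ q), ?_⟩
        have := h1 (by rw [show e.x (Φ q) = q.1 from h2.1]; exact hqI)
          (by rw [show e.y (Φ q) = q.2 from h2.2]; exact hqJ)
        filter_upwards [this] with z hz _ using hz)
    refine ⟨k, ?_⟩
    filter_upwards [hmem] with z hz hx hy
    exact (hk z (hz hx hy)).self_of_nhds trivial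

/-- Strict differentiability, uniformly near `p`: moving a little in a direction close to `n`
changes the coordinate `y` in the sense predicted by its derivative. -/
theorem eventually_sign {n : ℂ} (hn : e.Ly n ≠ 0) :
    ∀ᶠ q : ℂ × ℝ × ℂ in 𝓝 (p, 0, n),
      q.2.1 ≠ 0 → 0 < (e.y (q.1 + q.2.1 * q.2.2) - e.y q.1) * q.2.1 * e.Ly n := by
  -- With this constant, for vectors of norm at most `‖n‖ + 1`, the error term is at most a quarter
  -- of the main term for `n`.
  have hc : 0 < |e.Ly n| / (4 * (‖n‖ + 1)) := by positivity
  have ho := e.hy.isLittleO.def hc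
  have ht : Filter.Tendsto (fun q : ℂ × ℝ × ℂ => (q.1 + q.2.1 * q.2.2, q.1)) (𝓝 (p, 0, n))
      (𝓝 (p, p)) := by
    have : Continuous fun q : ℂ × ℝ × ℂ => (q.1 + q.2.1 * q.2.2, q.1) := by fun_prop
    simpa using this.tendsto (p, 0, n)
  have hnorm : ∀ᶠ q : ℂ × ℝ × ℂ in 𝓝 (p, 0, n), ‖q.2.2‖ < ‖n‖ + 1 := by
    have : Continuous fun q : ℂ × ℝ × ℂ => ‖q.2.2‖ := by fun_prop
    exact (this.tendsto _).eventually_lt_const (by simp)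
  have hpos : ∀ᶠ q : ℂ × ℝ × ℂ in 𝓝 (p, 0, n), (e.Ly n) ^ 2 / 2 < e.Ly q.2.2 * e.Ly n := by
    have : Continuous fun q : ℂ × ℝ × ℂ => e.Ly q.2.2 * e.Ly n := by fun_prop
    refine (this.tendsto _).eventually_const_lt ?_
    have : 0 < (e.Ly n) ^ 2 := by positivity
    simp only; nlinarith
  filter_upwards [ht.eventually ho, hnorm, hpos] with q h1 h2 h3 h0
  obtain ⟨z, h, u⟩ := q
  simp only at h1 h2 h3 h0 ⊢
  have hL : e.Ly (z + h * u - z) = h * e.Ly u := by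
    rw [add_sub_cancel_left, ← Complex.real_smul, map_smul, smul_eq_mul]
  rw [hL, add_sub_cancel_left, norm_mul, Complex.norm_real, Real.norm_eq_abs, Real.norm_eq_abs]
    at h1
  have h4 : |e.Ly n| / (4 * (‖n‖ + 1)) * (|h| * ‖u‖) ≤ |e.Ly n| * |h| / 4 := by
    have : 0 < ‖n‖ + 1 := by positivity
    rw [div_mul_eq_mul_div, div_le_div_iff₀ (by positivity) (by norm_num)]
    have : |e.Ly n| * |h| * ‖u‖ ≤ |e.Ly n| * |h| * (‖n‖ + 1) := by gcongr
    nlinarith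
  have h5 : |(e.y (z + h * u) - e.y z - h * e.Ly u) * (h * e.Ly n)| ≤
      (h ^ 2 * (e.Ly n) ^ 2) / 4 := by
    rw [abs_mul, abs_mul]
    calc _ ≤ |e.Ly n| * |h| / 4 * (|h| * |e.Ly n|) := by gcongr; exact h1.trans h4
      _ = |h| ^ 2 * |e.Ly n| ^ 2 / 4 := by ring
      _ = _ := by rw [sq_abs, sq_abs]
  have h6 := (abs_le.1 h5).1
  have hh : 0 < h ^ 2 := by positivity
  have hl : 0 < (e.Ly n) ^ 2 := by positivity
  have h7 := mul_lt_mul_of_pos_left h3 hh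
  have h8 := mul_pos hh hl
  nlinarith

/-- The ray at `p` with direction `a • v + b • w` enters the corresponding quadrant. -/
theorem eventually_ray (a b : ℤˣ) :
    ∀ᶠ δ : ℝ in 𝓝[>] 0, 0 < ((b : ℤ) : ℝ) *
      (e.y (p + δ * (((a : ℤ) : ℂ) * v + ((b : ℤ) : ℂ) * w)) - u₀) := by
  set n : ℂ := ((a : ℤ) : ℂ) * v + ((b : ℤ) : ℂ) * w with hn
  have hL : e.Ly n = (b : ℤ) := by
    have : n = ((a : ℤ) : ℝ) • v + ((b : ℤ) : ℝ) • w := by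
      simp only [Complex.real_smul, Complex.ofReal_intCast, hn]
    rw [this, map_add, map_smul, map_smul, e.Ly_v, e.Ly_w]
    simp
  have hne : e.Ly n ≠ 0 := by rw [hL]; exact_mod_cast b.ne_zero
  have ht : Filter.Tendsto (fun δ : ℝ => (p, δ, n)) (𝓝 0) (𝓝 (p, 0, n)) :=
    Continuous.tendsto (by fun_prop) _
  filter_upwards [nhdsWithin_le_nhds (ht.eventually (e.eventually_sign hne)),
    self_mem_nhdsWithin] with δ h1 h2
  have hδ : 0 < δ := h2
  have := h1 hδ.ne'
  simp only [e.y_p, hL] at this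
  refine pos_of_mul_pos_left (b := δ) ?_ hδ.le
  linarith

end Straightening

/-! ### The complement of the curve and jumps across it -/

namespace LongPlaneCurve

variable (C : LongPlaneCurve)

/-- The complement of the curve. -/
def offCurve : Set ℂ := (Set.range C.γ)ᶜ

/-- The time `t` is simple if the curve does not pass through `γ t` at any other time. -/
def IsSimpleTime (t : ℝ) : Prop := ∀ t', C.γ t' = C.γ t → t' = t

/-- The value of `g` just to the left of the curve at time `t` exceeds the value just to the right
by `j`. -/
def HasJump (g : ℂ → ℤ) (t : ℝ) (j : ℤ) : Prop :=
  ∀ᶠ ε : ℝ in 𝓝[>] 0,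
    g (C.γ t + ε * (Complex.I * deriv C.γ t)) - g (C.γ t - ε * (Complex.I * deriv C.γ t)) = j

theorem continuous_γ : Continuous C.γ := C.contDiff.continuous

theorem continuous_deriv : Continuous (deriv C.γ) := C.contDiff.continuous_deriv le_rfl

theorem hasStrictDerivAt (t : ℝ) : HasStrictDerivAt C.γ (deriv C.γ t) t :=
  C.contDiff.contDiffAt.hasStrictDerivAt one_ne_zero

theorem isClosedMap_γ : IsClosedMap C.γ := by
  have h : IsProperMap C.γ := by
    refine isProperMap_iff_tendsto_cocompact.2 ⟨C.continuous_γ, ?_⟩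
    obtain ⟨R, hR⟩ := C.standard_at_infinity
    have h1 : Filter.Tendsto (fun t : ℝ => (t : ℂ)) (Filter.cocompact ℝ) (Filter.cocompact ℂ) :=
      Complex.isometry_ofReal.isClosedEmbedding.tendsto_cocompact
    refine h1.congr' ?_
    have h2 : ∀ᶠ t : ℝ in Filter.cocompact ℝ, R ≤ ‖t‖ :=
      (tendsto_norm_cocompact_atTop).eventually_ge_atTop R
    filter_upwards [h2] with t ht
    exact (hR t ht).symm
  exact h.isClosedMap

theorem isOpen_offCurve : IsOpen C.offCurve := C.isClosedMap_γ.isClosed_range.isOpen_compl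

theorem dense_offCurve : Dense C.offCurve :=
  C.contDiff.dense_compl_range_of_finrank_lt_finrank (by simp)

variable {C}

theorem eventually_mem_offCurve {z : ℂ} (hz : z ∈ C.offCurve) : ∀ᶠ w in 𝓝 z, w ∈ C.offCurve :=
  C.isOpen_offCurve.mem_nhds hz

theorem Crossing.eq_first_or_second (c : C.Crossing) {t : ℝ} (h : C.γ t = C.γ c.first) :
    t = c.first ∨ t = c.second := by
  by_contra! hne
  have h12 := c.first_lt_second
  have hd := c.double_point
  rcases lt_or_gt_of_ne hne.1 with h1 | h1
  · exact C.no_triple_points _ _ _ h1 h12 ⟨h, hd⟩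
  · rcases lt_or_gt_of_ne hne.2 with h2 | h2
    · exact C.no_triple_points _ _ _ h1 h2 ⟨h.symm, h.trans hd⟩
    · exact C.no_triple_points _ _ _ h12 h2 ⟨hd, hd.symm.trans h.symm⟩

/-- Every point of the plane is off the curve, a simple point, or a crossing. -/
theorem point_cases (C : LongPlaneCurve) (p : ℂ) :
    p ∈ C.offCurve ∨ (∃ t, C.IsSimpleTime t ∧ C.γ t = p) ∨ ∃ c : C.Crossing, C.γ c.first = p := by
  by_cases hp : p ∈ C.offCurve
  · exact Or.inl hp
  right
  obtain ⟨t, rfl⟩ : p ∈ Set.range C.γ := not_not.1 hp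
  by_cases ht : C.IsSimpleTime t
  · exact Or.inl ⟨t, ht, rfl⟩
  right
  simp only [IsSimpleTime, not_forall] at ht
  obtain ⟨t', h, hne⟩ := ht
  rcases lt_or_gt_of_ne hne with h1 | h1
  · exact ⟨⟨t', t, h1, h⟩, h⟩
  · exact ⟨⟨t, t', h1, h.symm⟩, rfl⟩

theorem IsSimpleTime.eventually_time {t : ℝ} (ht : C.IsSimpleTime t) {P : ℝ → Prop}
    (hP : ∀ᶠ s in 𝓝 t, P s) : ∀ᶠ z in 𝓝 (C.γ t), ∀ s, C.γ s = z → P s := by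
  refine C.isClosedMap_γ.eventually_nhds_fiber (C.γ t) fun s hs => ?_
  obtain rfl := ht s hs
  exact hP

theorem Crossing.eventually_time (c : C.Crossing) {P : ℝ → Prop}
    (h1 : ∀ᶠ s in 𝓝 c.first, P s) (h2 : ∀ᶠ s in 𝓝 c.second, P s) :
    ∀ᶠ z in 𝓝 (C.γ c.first), ∀ s, C.γ s = z → P s := by
  refine C.isClosedMap_γ.eventually_nhds_fiber (C.γ c.first) fun s hs => ?_
  rcases c.eq_first_or_second hs with rfl | rfl
  exacts [h1, h2]

/-! ### Local coordinates along the curve -/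

section Chart

variable {β : ℝ → ℂ} {t u₀ : ℝ} {p w : ℂ}

theorem _root_.Straightening.eventually_y_ne (e : Straightening C.γ β t u₀ p (deriv C.γ t) w) :
    ∀ᶠ z in 𝓝 p, z ∈ C.offCurve → e.y z ≠ u₀ := by
  filter_upwards [e.left_inv] with z hz hzD hy
  refine hzD ⟨e.x z, ?_⟩
  rwa [hy, e.right_eq, add_sub_cancel_right] at hz

/-- Points a little to the left or to the right of the curve are on the side of the axis `y = u₀`
which the orientation of the coordinates predicts. -/
theorem _root_.Straightening.eventually_side (e : Straightening C.γ β t u₀ p (deriv C.γ t) w)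
    (hw : cross (deriv C.γ t) w ≠ 0) :
    ∀ᶠ s in 𝓝 t, ∀ᶠ h : ℝ in 𝓝 0, h ≠ 0 →
      0 < h * cross (deriv C.γ t) w * (e.y (C.γ s + h * (Complex.I * deriv C.γ s)) - u₀) := by
  have hv : 0 < ‖deriv C.γ t‖ ^ 2 := by
    have := C.immersion t
    positivity
  have hn : e.Ly (Complex.I * deriv C.γ t) ≠ 0 := by
    rw [e.Ly_I_mul hw]
    exact div_ne_zero hv.ne' hw
  have hc : Filter.Tendsto (fun q : ℝ × ℝ => (C.γ q.1, q.2, Complex.I * deriv C.γ q.1))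
      (𝓝 (t, 0)) (𝓝 (p, 0, Complex.I * deriv C.γ t)) := by
    have h1 := C.continuous_γ
    have h2 := C.continuous_deriv
    have : Continuous fun q : ℝ × ℝ => (C.γ q.1, q.2, Complex.I * deriv C.γ q.1) := by fun_prop
    simpa [e.left_eq] using this.tendsto (t, 0)
  have h3 := hc.eventually (e.eventually_sign hn)
  rw [nhds_prod_eq] at h3
  filter_upwards [h3.curry, e.right_inv_left] with s hs hy
  filter_upwards [hs] with h hh h0
  have := hh h0
  simp only [hy.2, e.Ly_I_mul hw] at this
  have h4 : ∀ Y : ℝ, h * cross (deriv C.γ t) w * Y =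
      (Y * h * (‖deriv C.γ t‖ ^ 2 / cross (deriv C.γ t) w)) *
        (cross (deriv C.γ t) w ^ 2 / ‖deriv C.γ t‖ ^ 2) := fun Y => by
    have := hv.ne'
    rw [ne_eq, sq_eq_zero_iff] at this
    field_simp
  rw [h4]
  exact mul_pos this (by positivity)

/-- A function with constant values on the two sides of a strand jumps by their difference. -/
theorem _root_.Straightening.eventually_hasJump (e : Straightening C.γ β t u₀ p (deriv C.γ t) w)
    {σ : ℤˣ} (hσ : 0 < (σ : ℤ) * cross (deriv C.γ t) w) {I : Set ℝ} (hI : IsOpen I) {g : ℂ → ℤ}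
    {k : ℤˣ → ℤ} (hk : ∀ᶠ z in 𝓝 p, ∀ b : ℤˣ, e.x z ∈ I → 0 < (b : ℤ) * (e.y z - u₀) → g z = k b) :
    ∀ᶠ s in 𝓝 t, s ∈ I → C.HasJump g s (k σ - k (-σ)) := by
  have hw : cross (deriv C.γ t) w ≠ 0 := by rintro h; simp [h] at hσ
  have hγ : Filter.Tendsto C.γ (𝓝 t) (𝓝 p) := by
    simpa [e.left_eq] using C.continuous_γ.tendsto t
  filter_upwards [e.eventually_side hw, e.right_inv_left, hγ.eventually hk.eventually_nhds,
    hγ.eventually e.eventually_continuousAt_x] with s hside hxy hks hcont hsI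
  have hline : Filter.Tendsto (fun h : ℝ => C.γ s + h * (Complex.I * deriv C.γ s)) (𝓝 0)
      (𝓝 (C.γ s)) := by
    have : Continuous fun h : ℝ => C.γ s + h * (Complex.I * deriv C.γ s) := by fun_prop
    simpa using this.tendsto 0
  have hxI : ∀ᶠ h : ℝ in 𝓝 0, e.x (C.γ s + h * (Complex.I * deriv C.γ s)) ∈ I := by
    refine (hcont.tendsto.comp hline).eventually ?_
    rw [hxy.1]
    exact hI.mem_nhds hsI
  have key : ∀ᶠ h : ℝ in 𝓝 0, ∀ b : ℤˣ, 0 < (b : ℤ) * h →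
      g (C.γ s + h * (Complex.I * deriv C.γ s)) = k (b * σ) := by
    filter_upwards [hside, hline.eventually hks, hxI] with h h1 h2 h3 b hb
    have h0 : h ≠ 0 := by rintro rfl; simp at hb
    refine h2 _ h3 ?_
    have h4 := mul_pos (mul_pos hb hσ) (h1 h0)
    have h5 : 0 < (h * cross (deriv C.γ t) w) ^ 2 := by positivity
    refine pos_of_mul_pos_left (b := (h * cross (deriv C.γ t) w) ^ 2) ?_ h5.le
    push_cast
    nlinarith
  have hneg : Filter.Tendsto (fun h : ℝ => -h) (𝓝 0) (𝓝 0) := by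
    simpa using (continuous_neg (G := ℝ)).tendsto 0
  filter_upwards [nhdsWithin_le_nhds key, nhdsWithin_le_nhds (hneg.eventually key),
    self_mem_nhdsWithin] with ε h1 h2 hε
  have hε' : 0 < ε := hε
  have e1 := h1 1 (by simpa using hε')
  have e2 := h2 (-1) (by simpa using hε')
  rw [one_mul] at e1
  rw [neg_one_mul, Complex.ofReal_neg, neg_mul, ← sub_eq_add_neg] at e2
  rw [e1, e2]

end Chart

/-- Functions which are locally constant off the curve, at points close to `p`. -/
def LocConstNear (C : LongPlaneCurve) (g : ℂ → ℤ) (p : ℂ) : Prop :=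
  ∀ᶠ z in 𝓝 p, z ∈ C.offCurve → ∀ᶠ z' in 𝓝 z, g z' = g z

/-- The sign of a real number as a unit; the value at `0` is irrelevant. -/
noncomputable def signUnit (r : ℝ) : ℤˣ := if 0 < r then 1 else -1

theorem signUnit_mul_pos {r : ℝ} (hr : r ≠ 0) : 0 < (signUnit r : ℤ) * r := by
  unfold signUnit
  split_ifs with h
  · simpa using h
  · simpa using lt_of_le_of_ne (not_lt.1 h) hr

theorem signUnit_eq {r : ℝ} {a : ℤˣ} (h : 0 < (a : ℤ) * r) : signUnit r = a := by
  unfold signUnit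
  rcases Int.units_eq_one_or a with rfl | rfl
  · simp at h; simp [h]
  · simp at h; simp [h.le]

theorem isOpen_unit_mul_sub_pos (a : ℤˣ) (s : ℝ) : IsOpen {r : ℝ | 0 < ((a : ℤ) : ℝ) * (r - s)} :=
  isOpen_lt continuous_const (by fun_prop)

theorem convex_unit_mul_sub_pos (a : ℤˣ) (s : ℝ) :
    Convex ℝ {r : ℝ | 0 < ((a : ℤ) : ℝ) * (r - s)} := by
  rcases Int.units_eq_one_or a with rfl | rfl
  · have : {r : ℝ | 0 < (((1 : ℤˣ) : ℤ) : ℝ) * (r - s)} = Set.Ioi s := by ext; simp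
    rw [this]
    exact convex_Ioi s
  · have : {r : ℝ | 0 < (((-1 : ℤˣ) : ℤ) : ℝ) * (r - s)} = Set.Iio s := by ext; simp
    rw [this]
    exact convex_Iio s

theorem eventually_signUnit_eq {f : ℂ → ℝ} {z : ℂ} {r : ℝ} (hf : ContinuousAt f z) (h : f z ≠ r) :
    ∀ᶠ z' in 𝓝 z, signUnit (f z' - r) = signUnit (f z - r) := by
  have h1 := signUnit_mul_pos (sub_ne_zero.2 h)
  filter_upwards [hf.tendsto.eventually ((isOpen_unit_mul_sub_pos _ r).mem_nhds h1)] with z' hz'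
  exact signUnit_eq hz'

/-! ### Simple points -/

theorem cross_normal_pos (C : LongPlaneCurve) (t : ℝ) :
    0 < cross (deriv C.γ t) (Complex.I * deriv C.γ t) := by
  rw [cross_self_I_mul]
  have := C.immersion t
  positivity

/-- Coordinates along the curve and its normal line. -/
theorem nonempty_simpleChart (C : LongPlaneCurve) (t : ℝ) :
    Nonempty (Straightening C.γ (fun u : ℝ => C.γ t + u * (Complex.I * deriv C.γ t)) t 0 (C.γ t)
      (deriv C.γ t) (Complex.I * deriv C.γ t)) := by
  refine Straightening.nonempty (C.hasStrictDerivAt t) ?_ (C.cross_normal_pos t).ne' rfl (by simp)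
  have h1 : HasStrictDerivAt (fun u : ℝ => (u : ℂ)) 1 0 := Complex.ofRealCLM.hasStrictDerivAt
  simpa using (h1.mul_const (Complex.I * deriv C.γ t)).const_add (C.γ t)

/-- Any jump is realised near a point of the curve, by a function supported on one side. -/
theorem exists_hasJump (C : LongPlaneCurve) (t : ℝ) (j : ℤ) :
    ∃ g, C.LocConstNear g (C.γ t) ∧ ∀ᶠ s in 𝓝 t, C.HasJump g s j := by
  obtain ⟨e⟩ := C.nonempty_simpleChart t
  let q : ℤˣ → ℤ := fun b => if b = 1 then j else 0
  refine ⟨fun z => q (signUnit (e.y z - 0)), ?_, ?_⟩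
  · filter_upwards [e.eventually_y_ne, e.eventually_continuousAt_y] with z h1 h2 hz
    filter_upwards [eventually_signUnit_eq h2 (h1 hz)] with z' hz'
    rw [hz']
  · have := e.eventually_hasJump (σ := 1) (by simpa using C.cross_normal_pos t) isOpen_univ (k := q)
      (g := fun z => q (signUnit (e.y z - 0)))
      (Filter.Eventually.of_forall fun z b _ hb => by simp only [signUnit_eq hb])
    filter_upwards [this] with s hs
    simpa [q] using hs trivial

namespace IsSimpleTime

variable {t : ℝ}

theorem eventually_mem_offCurve (ht : C.IsSimpleTime t) {β : ℝ → ℂ} {w : ℂ} {u₀ : ℝ}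
    (e : Straightening C.γ β t u₀ (C.γ t) (deriv C.γ t) w) :
    ∀ᶠ z in 𝓝 (C.γ t), e.y z ≠ u₀ → z ∈ C.offCurve := by
  filter_upwards [ht.eventually_time e.right_inv_left] with z hz hy
  rintro ⟨s, rfl⟩
  exact hy (hz s rfl).2

theorem eventually_normal_mem (ht : C.IsSimpleTime t) :
    ∀ᶠ h : ℝ in 𝓝 0, h ≠ 0 → C.γ t + h * (Complex.I * deriv C.γ t) ∈ C.offCurve := by
  obtain ⟨e⟩ := C.nonempty_simpleChart t
  have hline : Filter.Tendsto (fun h : ℝ => C.γ t + h * (Complex.I * deriv C.γ t)) (𝓝 0)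
      (𝓝 (C.γ t)) := by
    have : Continuous fun h : ℝ => C.γ t + h * (Complex.I * deriv C.γ t) := by fun_prop
    simpa using this.tendsto 0
  filter_upwards [(e.eventually_side (C.cross_normal_pos t).ne').self_of_nhds,
    hline.eventually (ht.eventually_mem_offCurve e)] with h h1 h2 h0
  refine h2 fun h3 => ?_
  have := h1 h0
  rw [h3] at this
  simp at this

/-- A locally constant function has two values near a simple point. -/
theorem exists_side_values (ht : C.IsSimpleTime t) {g : ℂ → ℤ} (hg : C.LocConstNear g (C.γ t)) :
    ∃ q : ℤˣ → ℤ, (∀ᶠ z in 𝓝 (C.γ t), z ∈ C.offCurve → ∃ b, g z = q b) ∧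
      ∀ᶠ s in 𝓝 t, C.HasJump g s (q 1 - q (-1)) := by
  obtain ⟨e⟩ := C.nonempty_simpleChart t
  have hb : ∀ b : ℤˣ, ∃ k, ∀ᶠ z in 𝓝 (C.γ t), e.x z ∈ Set.univ →
      e.y z ∈ {r : ℝ | 0 < ((b : ℤ) : ℝ) * (r - 0)} → g z = k := by
    intro b
    refine e.exists_const_of_convex C.continuous_γ (by fun_prop) convex_univ
      (convex_unit_mul_sub_pos b 0) ?_
    filter_upwards [hg, ht.eventually_mem_offCurve e] with z h1 h2 _ hz
    refine h1 (h2 ?_)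
    intro h0
    simp [h0] at hz
  choose q hq using hb
  have hq' := Filter.eventually_all.2 hq
  refine ⟨q, ?_, ?_⟩
  · filter_upwards [hq', e.eventually_y_ne] with z h1 h2 hz
    exact ⟨_, h1 _ trivial (signUnit_mul_pos (sub_ne_zero.2 (h2 hz)))⟩
  · have := e.eventually_hasJump (σ := 1) (by simpa using C.cross_normal_pos t) isOpen_univ (k := q)
      (g := g) (by filter_upwards [hq'] with z hz b using hz b)
    filter_upwards [this] with s hs using hs trivial

end IsSimpleTime

/-! ### Crossings -/

namespace Crossing

variable (c : C.Crossing)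

theorem cross_ne_zero : cross (deriv C.γ c.first) (deriv C.γ c.second) ≠ 0 :=
  cross_ne_zero_of_linearIndependent (C.transverse _ _ c.first_lt_second c.double_point)

/-- The orientation of the pair (direction of the first passage, direction of the second). -/
noncomputable def orientation : ℤˣ := signUnit (cross (deriv C.γ c.first) (deriv C.γ c.second))

/-- The function `g` has the value `q a b` on the quadrant at the crossing `c` into which the vector
`a • (first direction) + b • (second direction)` points, and the jumps across the four half strands
are the corresponding differences. -/
structure QuadrantValues (g : ℂ → ℤ) (q : ℤˣ → ℤˣ → ℤ) : Prop where
  near : ∀ᶠ z in 𝓝 (C.γ c.first), z ∈ C.offCurve → ∃ a b, g z = q a b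
  jump_first : ∀ a : ℤˣ, ∀ᶠ s in 𝓝 c.first, 0 < ((a : ℤ) : ℝ) * (s - c.first) →
    C.HasJump g s (q a c.orientation - q a (-c.orientation))
  jump_second : ∀ b : ℤˣ, ∀ᶠ s in 𝓝 c.second, 0 < ((b : ℤ) : ℝ) * (s - c.second) →
    C.HasJump g s (q (-c.orientation) b - q c.orientation b)
  ray : ∀ a b : ℤˣ, ∀ᶠ δ : ℝ in 𝓝[>] 0,
    g (C.γ c.first + δ * (((a : ℤ) : ℂ) * deriv C.γ c.first +
      ((b : ℤ) : ℂ) * deriv C.γ c.second)) = q a b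

theorem nonempty_chart : Nonempty (Straightening C.γ C.γ c.first c.second (C.γ c.first)
    (deriv C.γ c.first) (deriv C.γ c.second)) :=
  Straightening.nonempty (C.hasStrictDerivAt _) (C.hasStrictDerivAt _) c.cross_ne_zero rfl
    c.double_point.symm

variable {c}

theorem eventually_mem_offCurve (e : Straightening C.γ C.γ c.first c.second (C.γ c.first)
    (deriv C.γ c.first) (deriv C.γ c.second)) :
    ∀ᶠ z in 𝓝 (C.γ c.first), e.x z ≠ c.first → e.y z ≠ c.second → z ∈ C.offCurve := by
  have h1 : ∀ᶠ s in 𝓝 c.first, e.x (C.γ s) = c.first ∨ e.y (C.γ s) = c.second := by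
    filter_upwards [e.right_inv_left] with s hs using Or.inr hs.2
  have h2 : ∀ᶠ s in 𝓝 c.second, e.x (C.γ s) = c.first ∨ e.y (C.γ s) = c.second := by
    filter_upwards [e.swap.right_inv_left] with s hs using Or.inl hs.2
  filter_upwards [c.eventually_time h1 h2] with z hz hx hy
  rintro ⟨s, rfl⟩
  exact (hz s rfl).elim hx hy

theorem quadrantValues_of_coords (e : Straightening C.γ C.γ c.first c.second (C.γ c.first)
    (deriv C.γ c.first) (deriv C.γ c.second)) {g : ℂ → ℤ} {q : ℤˣ → ℤˣ → ℤ}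
    (hq : ∀ᶠ z in 𝓝 (C.γ c.first), ∀ a b : ℤˣ, 0 < ((a : ℤ) : ℝ) * (e.x z - c.first) →
      0 < ((b : ℤ) : ℝ) * (e.y z - c.second) → g z = q a b) : c.QuadrantValues g q where
  near := by
    have h := e.swap.eventually_y_ne
    filter_upwards [hq, e.eventually_y_ne, h] with z h1 h2 h3 hz
    exact ⟨_, _, h1 _ _ (signUnit_mul_pos (sub_ne_zero.2 (h3 hz)))
      (signUnit_mul_pos (sub_ne_zero.2 (h2 hz)))⟩
  jump_first a := e.eventually_hasJump (signUnit_mul_pos c.cross_ne_zero)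
    (isOpen_unit_mul_sub_pos a c.first) (k := q a)
    (by filter_upwards [hq] with z hz b h1 h2 using hz a b h1 h2)
  jump_second b := by
    have h0 : 0 < ((-c.orientation : ℤˣ) : ℤ) * cross (deriv C.γ c.second) (deriv C.γ c.first) := by
      rw [cross_swap (deriv C.γ c.first)]
      simpa [orientation] using signUnit_mul_pos c.cross_ne_zero
    have := e.swap.eventually_hasJump h0
      (isOpen_unit_mul_sub_pos b c.second) (k := fun a => q a b) (g := g)
      (by filter_upwards [hq] with z hz a h1 h2 using hz a b h2 h1)
    simpa using this
  ray a b := by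
    have hline : Filter.Tendsto (fun δ : ℝ => C.γ c.first + δ * (((a : ℤ) : ℂ) *
        deriv C.γ c.first + ((b : ℤ) : ℂ) * deriv C.γ c.second)) (𝓝[>] 0) (𝓝 (C.γ c.first)) := by
      have : Continuous (fun δ : ℝ => C.γ c.first + δ * (((a : ℤ) : ℂ) *
        deriv C.γ c.first + ((b : ℤ) : ℂ) * deriv C.γ c.second)) := by fun_prop
      have h := this.tendsto 0
      simp only [Complex.ofReal_zero, zero_mul, add_zero] at h
      exact h.mono_left nhdsWithin_le_nhds
    have hx : ∀ᶠ δ : ℝ in 𝓝[>] 0, 0 < ((a : ℤ) : ℝ) * (e.x (C.γ c.first + δ * (((a : ℤ) : ℂ) *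
        deriv C.γ c.first + ((b : ℤ) : ℂ) * deriv C.γ c.second)) - c.first) := by
      have := e.swap.eventually_ray b a
      simp only [add_comm (((b : ℤ) : ℂ) * deriv C.γ c.second)] at this
      exact this
    filter_upwards [hline.eventually hq, hx, e.eventually_ray a b] with δ h1 h2 h3
    exact h1 a b h2 h3

variable (c)

theorem exists_quadrantValues {g : ℂ → ℤ} (hg : C.LocConstNear g (C.γ c.first)) :
    ∃ q, c.QuadrantValues g q := by
  obtain ⟨e⟩ := c.nonempty_chart
  have hb : ∀ a b : ℤˣ, ∃ k, ∀ᶠ z in 𝓝 (C.γ c.first),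
      e.x z ∈ {r : ℝ | 0 < ((a : ℤ) : ℝ) * (r - c.first)} →
      e.y z ∈ {r : ℝ | 0 < ((b : ℤ) : ℝ) * (r - c.second)} → g z = k := by
    intro a b
    refine e.exists_const_of_convex C.continuous_γ C.continuous_γ (convex_unit_mul_sub_pos a _)
      (convex_unit_mul_sub_pos b _) ?_
    filter_upwards [hg, eventually_mem_offCurve e] with z h1 h2 hx hy
    refine h1 (h2 ?_ ?_)
    · intro h0
      simp [h0] at hx
    · intro h0
      simp [h0] at hy
  choose q hq using hb
  exact ⟨q, quadrantValues_of_coords e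
    (Filter.eventually_all.2 fun a => Filter.eventually_all.2 (hq a))⟩

theorem exists_of_quadrant (q : ℤˣ → ℤˣ → ℤ) :
    ∃ g, C.LocConstNear g (C.γ c.first) ∧ c.QuadrantValues g q := by
  obtain ⟨e⟩ := c.nonempty_chart
  refine ⟨fun z => q (signUnit (e.x z - c.first)) (signUnit (e.y z - c.second)), ?_,
    quadrantValues_of_coords e (Filter.Eventually.of_forall fun z a b ha hb => ?_)⟩
  · have h := e.swap.eventually_y_ne
    filter_upwards [e.eventually_y_ne, h, e.eventually_continuousAt_y,
      e.eventually_continuousAt_x] with z h1 h2 h3 h4 hz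
    filter_upwards [eventually_signUnit_eq h3 (h1 hz), eventually_signUnit_eq h4 (h2 hz)]
      with z' h5 h6
    rw [h5, h6]
  · simp only [signUnit_eq ha, signUnit_eq hb]

end Crossing

end LongPlaneCurve

namespace LongPlaneCurve

variable {C : LongPlaneCurve}

/-! ### Functions with prescribed jumps -/

namespace HasJump

variable {g g' : ℂ → ℤ} {t : ℝ} {j j' : ℤ}

theorem unique (h : C.HasJump g t j) (h' : C.HasJump g t j') : j = j' := by
  obtain ⟨ε, h1, h2⟩ := (Filter.Eventually.and h h').exists
  exact h1.symm.trans h2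

theorem sub (h : C.HasJump g t j) (h' : C.HasJump g' t j') :
    C.HasJump (fun z => g z - g' z) t (j - j') := by
  filter_upwards [h, h'] with ε h1 h2
  rw [← h1, ← h2]; ring

theorem sum_mul {ι : Type*} {s : Finset ι} {w : ι → ℂ → ℤ} {J : ι → ℤ} (a : ι → ℤ)
    (h : ∀ i ∈ s, C.HasJump (w i) t (J i)) :
    C.HasJump (fun z => ∑ i ∈ s, a i * w i z) t (∑ i ∈ s, a i * J i) := by
  filter_upwards [(Filter.eventually_all_finset s).2 h] with ε hε
  rw [← Finset.sum_sub_distrib]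
  refine Finset.sum_congr rfl fun i hi => ?_
  rw [← hε i hi]; ring

/-- At a simple time both points `γ t ± ε i γ' t` are off the curve for small `ε`, so that values on
the curve do not matter. -/
theorem of_eventually_sub_eq (ht : C.IsSimpleTime t) (h : C.HasJump g t j) {k : ℤ}
    (hk : ∀ᶠ z in 𝓝 (C.γ t), z ∈ C.offCurve → g' z - g z = k) : C.HasJump g' t j := by
  have hline : Filter.Tendsto (fun h : ℝ => C.γ t + h * (Complex.I * deriv C.γ t)) (𝓝 0)
      (𝓝 (C.γ t)) := by
    have : Continuous fun h : ℝ => C.γ t + h * (Complex.I * deriv C.γ t) := by fun_prop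
    simpa using this.tendsto 0
  have key := (hline.eventually hk).and ht.eventually_normal_mem
  have hneg : Filter.Tendsto (fun h : ℝ => -h) (𝓝 0) (𝓝 0) := by
    simpa using (continuous_neg (G := ℝ)).tendsto 0
  filter_upwards [h, nhdsWithin_le_nhds key, nhdsWithin_le_nhds (hneg.eventually key),
    self_mem_nhdsWithin] with ε h1 h2 h3 hε
  have hε0 : ε ≠ 0 := (show 0 < ε from hε).ne'
  have e1 := h2.1 (h2.2 hε0)
  have e2 := h3.1 (h3.2 (neg_ne_zero.2 hε0))
  rw [Complex.ofReal_neg, neg_mul, ← sub_eq_add_neg] at e2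
  omega

end HasJump

/-- Functions which are locally constant off the curve. -/
def LocConst (C : LongPlaneCurve) (g : ℂ → ℤ) : Prop :=
  ∀ z ∈ C.offCurve, ∀ᶠ z' in 𝓝 z, g z' = g z

theorem LocConst.near {g : ℂ → ℤ} (hg : C.LocConst g) (p : ℂ) : C.LocConstNear g p :=
  Filter.Eventually.of_forall hg

theorem LocConstNear.sub {g g' : ℂ → ℤ} {p : ℂ} (hg : C.LocConstNear g p)
    (hg' : C.LocConstNear g' p) : C.LocConstNear (fun z => g z - g' z) p := by
  filter_upwards [hg, hg'] with z h1 h2 hz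
  filter_upwards [h1 hz, h2 hz] with z' h3 h4
  rw [h3, h4]

theorem LocConst.sub {g g' : ℂ → ℤ} (hg : C.LocConst g) (hg' : C.LocConst g') :
    C.LocConst fun z => g z - g' z := by
  intro z hz
  filter_upwards [hg z hz, hg' z hz] with z' h3 h4
  rw [h3, h4]

theorem LocConst.sum_mul {ι : Type*} {s : Finset ι} {w : ι → ℂ → ℤ} (a : ι → ℤ)
    (h : ∀ i, C.LocConst (w i)) : C.LocConst fun z => ∑ i ∈ s, a i * w i z := by
  intro z hz
  filter_upwards [(Filter.eventually_all_finset s).2 fun i _ => h i z hz] with z' h3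
  exact Finset.sum_congr rfl fun i hi => by rw [h3 i hi]

/-- Functions which vanish far away, off the curve. -/
def VanishesFar (C : LongPlaneCurve) (g : ℂ → ℤ) : Prop :=
  ∃ R : ℝ, ∀ z ∈ C.offCurve, R < ‖z‖ → g z = 0

section Finite

variable [Finite C.Crossing]

theorem eventually_isSimpleTime (t : ℝ) : ∀ᶠ s in 𝓝[≠] t, C.IsSimpleTime s := by
  have hfin : {s | ¬ C.IsSimpleTime s}.Finite := by
    refine ((Set.finite_range (fun c : C.Crossing => c.first)).union
      (Set.finite_range (fun c : C.Crossing => c.second))).subset fun s hs => ?_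
    rcases C.point_cases (C.γ s) with h | ⟨t, ht, h⟩ | ⟨c, h⟩
    · exact absurd ⟨s, rfl⟩ h
    · obtain rfl := ht s h.symm
      exact absurd ht hs
    · rcases c.eq_first_or_second h.symm with rfl | rfl
      · exact Or.inl ⟨c, rfl⟩
      · exact Or.inr ⟨c, rfl⟩
  have h := (hfin.subset (Set.sdiff_subset (t := {t}))).isClosed.isOpen_compl.mem_nhds
    (show t ∈ ({s | ¬ C.IsSimpleTime s} \ {t})ᶜ from fun h => h.2 rfl)
  filter_upwards [nhdsWithin_le_nhds h, self_mem_nhdsWithin] with s h1 h2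
  by_contra h3
  exact h1 ⟨h3, h2⟩

theorem exists_isSimpleTime (a : ℤˣ) {t : ℝ} {P : ℝ → Prop} (hP : ∀ᶠ s in 𝓝 t, P s) :
    ∃ s, 0 < ((a : ℤ) : ℝ) * (s - t) ∧ C.IsSimpleTime s ∧ P s := by
  have h := C.eventually_isSimpleTime t
  rcases Int.units_eq_one_or a with rfl | rfl
  · have h1 : ∀ᶠ s in 𝓝[>] t, C.IsSimpleTime s :=
      h.filter_mono (nhdsWithin_mono _ fun s hs => ne_of_gt hs)
    obtain ⟨s, h2, h3, h4⟩ := (h1.and ((hP.filter_mono (nhdsWithin_le_nhds (s := Set.Ioi t))).and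
      self_mem_nhdsWithin)).exists
    exact ⟨s, by simpa using h4, h2, h3⟩
  · have h1 : ∀ᶠ s in 𝓝[<] t, C.IsSimpleTime s :=
      h.filter_mono (nhdsWithin_mono _ fun s hs => ne_of_lt hs)
    obtain ⟨s, h2, h3, h4⟩ := (h1.and ((hP.filter_mono (nhdsWithin_le_nhds (s := Set.Iio t))).and
      self_mem_nhdsWithin)).exists
    exact ⟨s, by simpa using h4, h2, h3⟩

theorem dense_isSimpleTime : Dense {t | C.IsSimpleTime t} := fun t => by
  rw [mem_closure_iff_nhds]
  intro U hU
  obtain ⟨s, -, h1, h2⟩ := C.exists_isSimpleTime 1 (P := (· ∈ U)) hU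
  exact ⟨s, h2, h1⟩

/-- Locally, a function without jumps is constant off the curve. -/
theorem eventually_const_of_jump_zero {g : ℂ → ℤ} {p : ℂ} (hg : C.LocConstNear g p)
    (hj : ∀ᶠ z in 𝓝 p, ∀ t, C.γ t = z → C.IsSimpleTime t → C.HasJump g t 0) :
    ∃ k, ∀ᶠ z in 𝓝 p, z ∈ C.offCurve → g z = k := by
  rcases C.point_cases p with hp | ⟨t, ht, rfl⟩ | ⟨c, rfl⟩
  · refine ⟨g p, ?_⟩
    filter_upwards [hg.self_of_nhds hp] with z hz _ using hz
  · obtain ⟨q, h1, h2⟩ := ht.exists_side_values hg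
    have h3 := (h2.self_of_nhds).unique (hj.self_of_nhds t rfl ht)
    refine ⟨q 1, ?_⟩
    filter_upwards [h1] with z hz hzD
    obtain ⟨b, hb⟩ := hz hzD
    rcases Int.units_eq_one_or b with rfl | rfl
    · exact hb
    · omega
  · obtain ⟨q, hq⟩ := c.exists_quadrantValues hg
    have h1 : ∀ a, q a c.orientation = q a (-c.orientation) := fun a => by
      obtain ⟨s, hs, hs1, hs2, hs3⟩ := C.exists_isSimpleTime a
        ((hq.jump_first a).and ((C.continuous_γ.tendsto _).eventually hj))
      have := (hs2 hs).unique (hs3 s rfl hs1)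
      omega
    have h2 : ∀ b, q (-c.orientation) b = q c.orientation b := fun b => by
      have hj' := hj
      rw [c.double_point] at hj'
      obtain ⟨s, hs, hs1, hs2, hs3⟩ := C.exists_isSimpleTime b
        ((hq.jump_second b).and ((C.continuous_γ.tendsto _).eventually hj'))
      have := (hs2 hs).unique (hs3 s rfl hs1)
      omega
    refine ⟨q 1 1, ?_⟩
    filter_upwards [hq.near] with z hz hzD
    obtain ⟨a, b, hab⟩ := hz hzD
    rw [hab]
    have e1 := h1 1
    have e2 := h1 (-1)
    have e3 := h2 1
    have e4 := h2 (-1)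
    rcases Int.units_eq_one_or c.orientation with ho | ho <;> rw [ho] at e1 e2 e3 e4 <;>
      rcases Int.units_eq_one_or a with rfl | rfl <;>
      rcases Int.units_eq_one_or b with rfl | rfl <;>
      (try simp only [neg_neg] at e1 e2 e3 e4) <;> omega

/-- Jumps along the curve which are constant between crossings and satisfy Kirchhoff's law at each
crossing are the jumps of a function. -/
theorem exists_locConst_of_jumps (J : ℝ → ℤ)
    (hJs : ∀ t, C.IsSimpleTime t → ∀ᶠ s in 𝓝 t, J s = J t)
    (hJc : ∀ c : C.Crossing, ∃ j₁ j₂ : ℤˣ → ℤ,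
      (∀ a : ℤˣ, ∀ᶠ s in 𝓝 c.first, 0 < ((a : ℤ) : ℝ) * (s - c.first) → J s = j₁ a) ∧
      (∀ b : ℤˣ, ∀ᶠ s in 𝓝 c.second, 0 < ((b : ℤ) : ℝ) * (s - c.second) → J s = j₂ b) ∧
      j₁ 1 + j₂ 1 = j₁ (-1) + j₂ (-1)) :
    ∃ F, C.LocConst F ∧ ∀ t, C.IsSimpleTime t → C.HasJump F t (J t) := by
  have hloc : ∀ p, ∃ m, C.LocConstNear m p ∧
      ∀ᶠ z in 𝓝 p, ∀ t, C.γ t = z → C.IsSimpleTime t → C.HasJump m t (J t) := by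
    intro p
    rcases C.point_cases p with hp | ⟨t, ht, rfl⟩ | ⟨c, rfl⟩
    · refine ⟨fun _ => 0, by simp [LocConstNear], ?_⟩
      filter_upwards [eventually_mem_offCurve hp] with z hz t ht
      exact absurd ⟨t, ht⟩ hz
    · obtain ⟨m, h1, h2⟩ := C.exists_hasJump t (J t)
      refine ⟨m, h1, ht.eventually_time ?_⟩
      filter_upwards [h2, hJs t ht] with s h3 h4 _
      rwa [h4]
    · obtain ⟨j₁, j₂, h1, h2, h3⟩ := hJc c
      -- These quadrant values solve the four equations for the jumps, starting from the value `0`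
      -- on the quadrant `(-1, -1)`; the fourth equation is Kirchhoff's law.
      let q : ℤˣ → ℤˣ → ℤ := fun a b =>
        if a = 1 then (if b = 1 then c.orientation * (j₁ 1 - j₂ (-1)) else -c.orientation * j₂ (-1))
        else (if b = 1 then c.orientation * j₁ (-1) else 0)
      obtain ⟨m, hm, hq⟩ := c.exists_of_quadrant q
      refine ⟨m, hm, c.eventually_time ?_ ?_⟩
      · filter_upwards [Filter.eventually_all.2 h1, Filter.eventually_all.2 hq.jump_first]
          with s h4 h5 hs
        have hne : s ≠ c.first := by
          rintro rfl
          exact c.first_lt_second.ne' (hs _ c.double_point.symm)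
        have h6 := signUnit_mul_pos (sub_ne_zero.2 hne)
        rw [h4 _ h6]
        refine cast ?_ (h5 _ h6)
        congr 1
        rcases Int.units_eq_one_or (signUnit (s - c.first)) with ha | ha <;>
          rcases Int.units_eq_one_or c.orientation with ho | ho <;> simp [q, ho, ha]
      · filter_upwards [Filter.eventually_all.2 h2, Filter.eventually_all.2 hq.jump_second]
          with s h4 h5 hs
        have hne : s ≠ c.second := by
          rintro rfl
          exact c.first_lt_second.ne (hs _ c.double_point)
        have h6 := signUnit_mul_pos (sub_ne_zero.2 hne)
        rw [h4 _ h6]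
        refine cast ?_ (h5 _ h6)
        congr 1
        rcases Int.units_eq_one_or (signUnit (s - c.second)) with ha | ha <;>
          rcases Int.units_eq_one_or c.orientation with ho | ho <;> simp [q, ho, ha] <;> omega
  choose m hm hmj using hloc
  obtain ⟨F, hF⟩ := exists_global_of_local C.dense_offCurve m (by
    intro p
    filter_upwards [(hm p).eventually_nhds, (hmj p).eventually_nhds] with q h1 h2
    refine eventually_const_of_jump_zero (LocConstNear.sub h1 (hm q)) ?_
    filter_upwards [h2, hmj q] with z h3 h4 t ht hts
    have := (h3 t ht hts).sub (h4 t ht hts)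
    rwa [sub_self] at this)
  refine ⟨F, fun z hz => ?_, fun t ht => ?_⟩
  · obtain ⟨k, hk⟩ := hF z
    have h0 := hk.self_of_nhds hz
    filter_upwards [hk, (hm z).self_of_nhds hz, eventually_mem_offCurve hz] with z' h1 h2 h3
    have := h1 h3
    omega
  · obtain ⟨k, hk⟩ := hF (C.γ t)
    exact ((hmj _).self_of_nhds t rfl ht).of_eventually_sub_eq ht hk

/-- A function without jumps on a connected open set is constant there, off the curve. -/
theorem LocConst.eq_const_of_jump_zero {g : ℂ → ℤ} (hg : C.LocConst g) {O : Set ℂ} (hO : IsOpen O)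
    (hOc : IsPreconnected O) (hne : O.Nonempty)
    (hj : ∀ t, C.γ t ∈ O → C.IsSimpleTime t → C.HasJump g t 0) :
    ∃ k, ∀ z ∈ O, z ∈ C.offCurve → g z = k := by
  obtain ⟨k, hk⟩ := exists_const_of_eventually_const C.dense_offCurve hOc hne (F := g) (by
    intro p hp
    refine eventually_const_of_jump_zero (hg.near p) ?_
    filter_upwards [hO.mem_nhds hp] with z hz t ht
    subst ht
    exact hj t hz)
  exact ⟨k, fun z hz => (hk z hz).self_of_nhds⟩

end Finite

/-! ### The indices of the loops at the crossings -/

open Classical in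
/-- The indicator function of the span of a crossing. -/
noncomputable def Crossing.spanIndicator (k : C.Crossing) (t : ℝ) : ℤ :=
  if t ∈ Set.Ioo k.first k.second then 1 else 0

namespace Crossing

theorem eq_of_γ_eq {c k : C.Crossing} (h : C.γ c.first = C.γ k.first) : c = k := by
  have h1 := k.eq_first_or_second h
  have h2 := k.eq_first_or_second (c.double_point.symm.trans h)
  have h3 := c.first_lt_second
  have h4 := k.first_lt_second
  cases c; cases k
  simp only at h1 h2 h3 h4
  rcases h1 with rfl | rfl <;> rcases h2 with rfl | rfl
  · exact absurd h3 (lt_irrefl _)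
  · rfl
  · exact absurd h3 h4.not_gt
  · exact absurd h3 (lt_irrefl _)

theorem eventually_spanIndicator (k : C.Crossing) {t : ℝ} (h1 : t ≠ k.first) (h2 : t ≠ k.second) :
    ∀ᶠ s in 𝓝 t, k.spanIndicator s = k.spanIndicator t := by
  rcases lt_or_gt_of_ne h1 with h | h
  · filter_upwards [eventually_lt_nhds h] with s hs
    simp [spanIndicator, hs.not_gt, h.not_gt]
  · rcases lt_or_gt_of_ne h2 with h' | h'
    · filter_upwards [eventually_gt_nhds h, eventually_lt_nhds h'] with s hs hs'
      simp [spanIndicator, hs, hs', h, h']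
    · filter_upwards [eventually_gt_nhds h'] with s hs
      simp [spanIndicator, hs.not_gt, h'.not_gt]

open Classical in
theorem eventually_spanIndicator_first (k c : C.Crossing) (a : ℤˣ) :
    ∀ᶠ s in 𝓝 c.first, 0 < ((a : ℤ) : ℝ) * (s - c.first) →
      k.spanIndicator s = k.spanIndicator c.first + if k = c ∧ a = 1 then 1 else 0 := by
  by_cases hkc : k = c
  · subst hkc
    filter_upwards [eventually_lt_nhds k.first_lt_second] with s hs h
    rcases Int.units_eq_one_or a with rfl | rfl
    · have : k.first < s := by simpa using h
      simp [spanIndicator, this, hs]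
    · have : s < k.first := by simpa using h
      simp [spanIndicator, this.not_gt]
  · filter_upwards [k.eventually_spanIndicator (t := c.first)
      (fun h => hkc (eq_of_γ_eq (by rw [h])))
      (fun h => hkc (eq_of_γ_eq (by rw [h, k.double_point])))] with s hs _
    simp [hs, hkc]

open Classical in
theorem eventually_spanIndicator_second (k c : C.Crossing) (b : ℤˣ) :
    ∀ᶠ s in 𝓝 c.second, 0 < ((b : ℤ) : ℝ) * (s - c.second) →
      k.spanIndicator s = k.spanIndicator c.second + if k = c ∧ b = -1 then 1 else 0 := by
  by_cases hkc : k = c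
  · subst hkc
    filter_upwards [eventually_gt_nhds k.first_lt_second] with s hs h
    rcases Int.units_eq_one_or b with rfl | rfl
    · have : k.second < s := by simpa using h
      simp [spanIndicator, this.not_gt]
    · have : s < k.second := by simpa using h
      simp [spanIndicator, this, hs]
  · filter_upwards [k.eventually_spanIndicator (t := c.second)
      (fun h => hkc (eq_of_γ_eq (by rw [c.double_point, h])))
      (fun h => hkc (eq_of_γ_eq (by rw [c.double_point, h, k.double_point])))] with s hs _
    simp [hs, hkc]

/-- The index of the loop formed by the span of a crossing: a function on the complement of the
curve which vanishes far away and jumps by one exactly across the span. -/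
structure IsLoopIndex (k : C.Crossing) (w : ℂ → ℤ) : Prop where
  locConst : C.LocConst w
  hasJump : ∀ t, C.IsSimpleTime t → C.HasJump w t (k.spanIndicator t)
  vanishesFar : C.VanishesFar w

theorem exists_isLoopIndex [Finite C.Crossing] (k : C.Crossing) : ∃ w, k.IsLoopIndex w := by
  classical
  obtain ⟨F, hF, hFj⟩ := exists_locConst_of_jumps (C := C) k.spanIndicator
    (fun t ht => k.eventually_spanIndicator
      (fun h => k.first_lt_second.ne' (ht k.second (by rw [h, k.double_point]) |>.trans h))
      (fun h => k.first_lt_second.ne (ht k.first (by rw [h, k.double_point]) |>.trans h)))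
    (fun c => ⟨_, _, k.eventually_spanIndicator_first c, k.eventually_spanIndicator_second c, by
      by_cases h : k = c
      · simp [h]; ring
      · simp [h]⟩)
  obtain ⟨R, hR⟩ := (isCompact_Icc.image C.continuous_γ).isBounded.exists_norm_le
    (s := C.γ '' Set.Icc k.first k.second)
  have hR0 : (0 : ℝ) < |R| + 1 := by positivity
  obtain ⟨κ, hκ⟩ := hF.eq_const_of_jump_zero (O := {z : ℂ | |R| + 1 < ‖z‖})
    (isOpen_lt continuous_const continuous_norm) (isPreconnected_norm_gt hR0)
    (NormedSpace.exists_lt_norm ℝ ℂ _)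
    (by
      intro t ht hts
      have h0 : k.spanIndicator t = 0 := by
        unfold spanIndicator
        rw [if_neg]
        intro h
        have h1 := hR _ ⟨t, Set.Ioo_subset_Icc_self h, rfl⟩
        have h2 : |R| + 1 < ‖C.γ t‖ := ht
        linarith [le_abs_self R]
      rw [← h0]
      exact hFj t hts)
  refine ⟨fun z => F z - κ, fun z hz => ?_, fun t ht => ?_, |R| + 1, fun z hz h => ?_⟩
  · filter_upwards [hF z hz] with z' hz'
    rw [hz']
  · filter_upwards [hFj t ht] with ε hε
    rw [← hε]; ring
  · exact sub_eq_zero.2 (hκ z h hz)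

end Crossing

theorem LocConst.exists_jump {g : ℂ → ℤ} (hg : C.LocConst g) {t : ℝ}
    (ht : C.IsSimpleTime t) : ∃ j, ∀ᶠ s in 𝓝 t, C.HasJump g s j := by
  obtain ⟨q, -, h⟩ := ht.exists_side_values (hg.near _)
  exact ⟨_, h⟩

/-- The only function without jumps that vanishes far away is zero. More generally, it is enough
that the jump does not change at any time, since there is no jump at the beginning of the curve. -/
theorem LocConst.eq_zero [Finite C.Crossing] {g : ℂ → ℤ} (hg : C.LocConst g)
    (hfar : C.VanishesFar g)
    (hj : ∀ t, ∃ j, ∀ᶠ s in 𝓝 t, C.IsSimpleTime s → C.HasJump g s j) {z : ℂ}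
    (hz : z ∈ C.offCurve) : g z = 0 := by
  classical
  -- Simple times are dense, so that the locally constant jump is constant along the curve.
  let jmp : ℝ → ℤ := fun t => if h : ∃ j, C.HasJump g t j then h.choose else 0
  have hjmp : ∀ t j, C.HasJump g t j → jmp t = j := fun t j h => by
    have he : ∃ j, C.HasJump g t j := ⟨j, h⟩
    simp only [jmp, dif_pos he]
    exact he.choose_spec.unique h
  obtain ⟨j, hjc⟩ := exists_const_of_eventually_const (D := {t | C.IsSimpleTime t})
    C.dense_isSimpleTime (isPreconnected_univ (α := ℝ)) ⟨0, trivial⟩ (F := jmp) (by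
      intro t _
      obtain ⟨j, hj⟩ := hj t
      refine ⟨j, ?_⟩
      filter_upwards [hj] with s hs hss
      exact hjmp s j (hs hss))
  have hall : ∀ t, C.IsSimpleTime t → C.HasJump g t j := by
    intro t ht
    obtain ⟨j', hj'⟩ := hg.exists_jump ht
    have h1 := (hjc t trivial).self_of_nhds ht
    rw [hjmp t j' hj'.self_of_nhds] at h1
    rw [← h1]
    exact hj'.self_of_nhds
  obtain ⟨R, hR⟩ := hfar
  obtain ⟨R', hR'⟩ := C.standard_at_infinity
  have hj0 : j = 0 := by
    obtain ⟨s, hs, hs1, -⟩ := C.exists_isSimpleTime 1 (t := |R| + |R'| + 1) (P := fun _ => True)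
      (by simp)
    have hs' : |R| + |R'| + 1 < s := by simpa using hs
    have hs0 : 0 < s := by linarith [abs_nonneg R, abs_nonneg R']
    have hγ : C.γ s = s := hR' s (by
      rw [abs_of_pos hs0]; linarith [le_abs_self R', abs_nonneg R])
    refine (hall s hs1).unique ?_
    refine HasJump.of_eventually_sub_eq (g := fun _ => 0) (k := 0) hs1 (by simp [HasJump]) ?_
    have hlt : R < ‖C.γ s‖ := by
      rw [hγ, Complex.norm_real, Real.norm_eq_abs, abs_of_pos hs0]
      linarith [le_abs_self R, abs_nonneg R']
    filter_upwards [(continuous_norm.tendsto (C.γ s)).eventually_const_lt hlt] with z hz hzD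
    simpa using hR z hzD hz
  obtain ⟨κ, hκ⟩ := hg.eq_const_of_jump_zero isOpen_univ isPreconnected_univ ⟨0, trivial⟩
    (fun t _ ht => hj0 ▸ hall t ht)
  obtain ⟨y, hy, hyD⟩ := C.dense_offCurve.inter_open_nonempty {z : ℂ | |R| < ‖z‖}
    (isOpen_lt continuous_const continuous_norm) (NormedSpace.exists_lt_norm ℝ ℂ _)
  have hy' : |R| < ‖y‖ := hy
  rw [hκ z trivial hz, ← hκ y trivial hyD, hR y hyD (lt_of_le_of_lt (le_abs_self R) hy')]

/-- Every function which is locally constant off the curve and vanishes far away is a combination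
of the indices of the loops: the coefficient of a loop is the change of the jump at the first
passage through its crossing. -/
theorem LocConst.exists_combination [Fintype C.Crossing] {w : C.Crossing → ℂ → ℤ}
    (hw : ∀ k : C.Crossing, k.IsLoopIndex (w k)) {f : ℂ → ℤ} (hf : C.LocConst f)
    (hfar : C.VanishesFar f) :
    ∃ a : C.Crossing → ℤ, ∀ z ∈ C.offCurve, f z = ∑ k, a k * w k z := by
  classical
  have hq : ∀ c : C.Crossing, ∃ q, c.QuadrantValues f q := fun c =>
    c.exists_quadrantValues (hf.near _)
  choose q hq using hq
  let a : C.Crossing → ℤ := fun c => (q c 1 c.orientation - q c 1 (-c.orientation)) -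
    (q c (-1) c.orientation - q c (-1) (-c.orientation))
  refine ⟨a, fun z hz => ?_⟩
  have hsum : ∀ t, C.IsSimpleTime t → C.HasJump (fun z => ∑ k, a k * w k z) t
      (∑ k, a k * k.spanIndicator t) := fun t ht =>
    HasJump.sum_mul a fun k _ => (hw k).hasJump t ht
  refine sub_eq_zero.1 (LocConst.eq_zero (g := fun z => f z - ∑ k, a k * w k z)
    (hf.sub (LocConst.sum_mul a fun k => (hw k).locConst)) ?_ ?_ hz)
  · obtain ⟨R, hR⟩ := hfar
    choose r hr using fun k => (hw k).vanishesFar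
    refine ⟨|R| + ∑ k, |r k|, fun z hz h => ?_⟩
    have hs : ∀ k, |r k| ≤ ∑ k, |r k| := fun k =>
      Finset.single_le_sum (f := fun k => |r k|) (fun _ _ => abs_nonneg _) (Finset.mem_univ k)
    have hs0 : 0 ≤ ∑ k, |r k| := Finset.sum_nonneg fun _ _ => abs_nonneg _
    have h0 : ∀ k, w k z = 0 := fun k => hr k z hz (by
      linarith [hs k, le_abs_self (r k), abs_nonneg R])
    simp [h0, hR z hz (by linarith [le_abs_self R])]
  · intro t
    rcases C.point_cases (C.γ t) with h | ⟨t', ht, h⟩ | ⟨c, h⟩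
    · exact absurd ⟨t, rfl⟩ h
    · obtain rfl := ht t h.symm
      obtain ⟨j, hj⟩ := hf.exists_jump ht
      refine ⟨j - ∑ k, a k * k.spanIndicator t, ?_⟩
      have hloc : ∀ᶠ s in 𝓝 t, ∀ k : C.Crossing, k.spanIndicator s = k.spanIndicator t :=
        Filter.eventually_all.2 fun k => k.eventually_spanIndicator
          (fun h => k.first_lt_second.ne' (ht k.second (by rw [h, k.double_point]) |>.trans h))
          (fun h => k.first_lt_second.ne (ht k.first (by rw [h, k.double_point]) |>.trans h))
      filter_upwards [hj, hloc] with s h1 h2 hs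
      simpa only [h2] using h1.sub (hsum s hs)
    · rcases c.eq_first_or_second h.symm with rfl | rfl
      · refine ⟨q c (-1) c.orientation - q c (-1) (-c.orientation) -
          ∑ k, a k * k.spanIndicator c.first, ?_⟩
        filter_upwards [Filter.eventually_all.2 (hq c).jump_first, Filter.eventually_all.2
          fun k : C.Crossing => Filter.eventually_all.2 (k.eventually_spanIndicator_first c)]
          with s h1 h2 hs
        have hne : s ≠ c.first := by
          rintro rfl
          exact c.first_lt_second.ne' (hs _ c.double_point.symm)
        have h3 := signUnit_mul_pos (sub_ne_zero.2 hne)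
        have h4 := (h1 _ h3).sub (hsum s hs)
        simp only [h2 _ _ h3, mul_add, Finset.sum_add_distrib, mul_ite, mul_one, mul_zero] at h4
        refine cast ?_ h4
        congr 1
        rcases Int.units_eq_one_or (signUnit (s - c.first)) with ha | ha
        · simp [ha, a]; ring
        · simp [ha]
      · refine ⟨q c (-c.orientation) 1 - q c c.orientation 1 -
          ∑ k, a k * k.spanIndicator c.second, ?_⟩
        filter_upwards [Filter.eventually_all.2 (hq c).jump_second, Filter.eventually_all.2
          fun k : C.Crossing => Filter.eventually_all.2 (k.eventually_spanIndicator_second c)]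
          with s h1 h2 hs
        have hne : s ≠ c.second := by
          rintro rfl
          exact c.first_lt_second.ne (hs _ c.double_point)
        have h3 := signUnit_mul_pos (sub_ne_zero.2 hne)
        have h4 := (h1 _ h3).sub (hsum s hs)
        simp only [h2 _ _ h3, mul_add, Finset.sum_add_distrib, mul_ite, mul_one, mul_zero] at h4
        refine cast ?_ h4
        congr 1
        rcases Int.units_eq_one_or (signUnit (s - c.second)) with ha | ha
        · simp [ha]
        · rcases Int.units_eq_one_or c.orientation with ho | ho <;> simp [ha, a, ho] <;> ring

/-- The indices of the loops are linearly independent: the jump of a combination changes by the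
coefficient of a loop at the first passage through its crossing. -/
theorem eq_zero_of_combination_eq_zero [Fintype C.Crossing] {w : C.Crossing → ℂ → ℤ}
    (hw : ∀ k : C.Crossing, k.IsLoopIndex (w k)) {a : C.Crossing → ℤ}
    (ha : ∀ z ∈ C.offCurve, ∑ k, a k * w k z = 0) (c : C.Crossing) : a c = 0 := by
  classical
  have hs : ∀ t, C.IsSimpleTime t → ∑ k, a k * k.spanIndicator t = 0 := fun t ht => by
    refine (HasJump.sum_mul a fun k _ => (hw k).hasJump t ht).unique ?_
    refine HasJump.of_eventually_sub_eq (g := fun _ => 0) (k := 0) ht (by simp [HasJump]) ?_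
    exact Filter.Eventually.of_forall fun z hz => by simpa using ha z hz
  have hside : ∀ e : ℤˣ, ∑ k, a k * k.spanIndicator c.first + (if e = 1 then a c else 0) = 0 := by
    intro e
    obtain ⟨s, h1, h2, h3⟩ := C.exists_isSimpleTime e (Filter.eventually_all.2
      fun k : C.Crossing => k.eventually_spanIndicator_first c e)
    have h4 := hs s h2
    simp only [h3 _ h1, mul_add, Finset.sum_add_distrib, mul_ite, mul_one, mul_zero] at h4
    refine Eq.trans ?_ h4
    congr 1
    by_cases he : e = 1 <;> simp [he]
  have h1 := hside 1
  have h2 := hside (-1)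
  simp at h1 h2
  omega

end LongPlaneCurve

namespace LongKnotDiagram

variable {K : LongKnotDiagram}

/-! ### Regions -/

namespace IsRegion

variable {U U' : Set ℂ}

theorem subset_offCurve (hU : K.IsRegion U) : U ⊆ K.toLongPlaneCurve.offCurve := by
  obtain ⟨z, -, rfl⟩ := hU
  exact connectedComponentIn_subset _ _

theorem isOpen (hU : K.IsRegion U) : IsOpen U := by
  obtain ⟨z, -, rfl⟩ := hU
  exact K.toLongPlaneCurve.isOpen_offCurve.connectedComponentIn

theorem nonempty (hU : K.IsRegion U) : U.Nonempty := by
  obtain ⟨z, hz, rfl⟩ := hU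
  exact ⟨z, mem_connectedComponentIn hz⟩

theorem eq_of_mem (hU : K.IsRegion U) (hU' : K.IsRegion U') {z : ℂ} (hz : z ∈ U) (hz' : z ∈ U') :
    U = U' := by
  obtain ⟨y, -, rfl⟩ := hU
  obtain ⟨y', -, rfl⟩ := hU'
  rw [connectedComponentIn_eq hz, connectedComponentIn_eq hz']

theorem apply_eq (hU : K.IsRegion U) {g : ℂ → ℤ} (hg : K.toLongPlaneCurve.LocConst g) {z z' : ℂ}
    (hz : z ∈ U) (hz' : z' ∈ U) : g z = g z' := by
  obtain ⟨k, hk⟩ := exists_const_of_eventually_const (D := Set.univ) (O := U) (F := g) dense_univ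
    (by obtain ⟨y, -, rfl⟩ := hU; exact isPreconnected_connectedComponentIn) hU.nonempty
    (fun p hp => ⟨g p, by
      filter_upwards [hg p (hU.subset_offCurve hp)] with y hy _ using hy⟩)
  rw [(hk z hz).self_of_nhds trivial, (hk z' hz').self_of_nhds trivial]

theorem apply_eq_zero (hU : K.IsRegion U) (hub : ¬ Bornology.IsBounded U) {g : ℂ → ℤ}
    (hg : K.toLongPlaneCurve.LocConst g) (hfar : K.toLongPlaneCurve.VanishesFar g) {z : ℂ}
    (hz : z ∈ U) : g z = 0 := by
  obtain ⟨R, hR⟩ := hfar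
  obtain ⟨y, hy, hyR⟩ : ∃ y ∈ U, R < ‖y‖ := by
    by_contra! h
    exact hub (isBounded_iff_forall_norm_le.2 ⟨R, h⟩)
  rw [hU.apply_eq hg hz hy, hR y (hU.subset_offCurve hy) hyR]

end IsRegion

theorem exists_isRegion_mem {z : ℂ} (hz : z ∈ K.toLongPlaneCurve.offCurve) :
    ∃ U, K.IsRegion U ∧ z ∈ U :=
  ⟨_, ⟨z, hz, rfl⟩, mem_connectedComponentIn hz⟩

namespace BoundedRegion

/-- A point of a bounded region. -/
noncomputable def point (U : K.BoundedRegion) : ℂ := U.2.1.nonempty.some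

theorem point_mem (U : K.BoundedRegion) : U.point ∈ U.1 := U.2.1.nonempty.some_mem

theorem point_mem_offCurve (U : K.BoundedRegion) : U.point ∈ K.toLongPlaneCurve.offCurve :=
  U.2.1.subset_offCurve U.point_mem

open Classical in
/-- The indicator function of a bounded region. -/
noncomputable def indicator (U : K.BoundedRegion) (z : ℂ) : ℤ := if z ∈ U.1 then 1 else 0

open Classical in
theorem indicator_point (U U' : K.BoundedRegion) :
    U.indicator U'.point = if U = U' then 1 else 0 := by
  have : U'.point ∈ U.1 ↔ U = U' :=
    ⟨fun h => Subtype.ext (U.2.1.eq_of_mem U'.2.1 h U'.point_mem), fun h => h ▸ U.point_mem⟩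
  simp only [indicator, this]

theorem locConst_indicator (U : K.BoundedRegion) : K.toLongPlaneCurve.LocConst U.indicator := by
  intro z hz
  obtain ⟨V, hV, hzV⟩ := exists_isRegion_mem hz
  filter_upwards [hV.isOpen.mem_nhds hzV] with y hy
  have : y ∈ U.1 ↔ z ∈ U.1 := by
    constructor <;> intro h
    · rwa [U.2.1.eq_of_mem hV h hy]
    · rwa [U.2.1.eq_of_mem hV h hzV]
  classical exact if_congr this rfl rfl

theorem vanishesFar_indicator (U : K.BoundedRegion) :
    K.toLongPlaneCurve.VanishesFar U.indicator := by
  obtain ⟨R, hR⟩ := isBounded_iff_forall_norm_le.1 U.2.2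
  exact ⟨R, fun z _ h => if_neg fun hz => absurd (hR z hz) (not_le.2 h)⟩

end BoundedRegion

section Indices

variable [Fintype K.Crossing] {w : K.Crossing → ℂ → ℤ}

/-- The integral dual basis: the indicator functions of the bounded regions, as combinations of the
indices of the loops. -/
theorem exists_indicator_eq (hw : ∀ k : K.Crossing, k.IsLoopIndex (w k)) :
    ∃ v : K.BoundedRegion → K.Crossing → ℤ, ∀ U, ∀ z ∈ K.toLongPlaneCurve.offCurve,
      U.indicator z = ∑ k, v U k * w k z := by
  choose v hv using fun U : K.BoundedRegion =>
    LongPlaneCurve.LocConst.exists_combination hw U.locConst_indicator U.vanishesFar_indicator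
  exact ⟨v, hv⟩

/-- The coefficients of the indicator functions are linearly independent because the indicator
functions are. -/
theorem linearIndependent_indicator_coeff {v : K.BoundedRegion → K.Crossing → ℤ}
    (hv : ∀ U, ∀ z ∈ K.toLongPlaneCurve.offCurve, U.indicator z = ∑ k, v U k * w k z) :
    LinearIndependent ℤ v := by
  classical
  rw [linearIndependent_iff']
  intro s b hb U hU
  have h1 : ∑ U' ∈ s, b U' * U'.indicator U.point = 0 := by
    calc ∑ U' ∈ s, b U' * U'.indicator U.point
        = ∑ U' ∈ s, ∑ k, b U' * v U' k * w k U.point := by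
          refine Finset.sum_congr rfl fun U' _ => ?_
          rw [hv U' _ U.point_mem_offCurve, Finset.mul_sum]
          exact Finset.sum_congr rfl fun k _ => by ring
      _ = ∑ k, (∑ U' ∈ s, b U' • v U') k * w k U.point := by
          rw [Finset.sum_comm]
          refine Finset.sum_congr rfl fun k _ => ?_
          rw [Finset.sum_apply, Finset.sum_mul]
          rfl
      _ = 0 := by rw [hb]; simp
  simpa [BoundedRegion.indicator_point, hU] using h1

theorem linearIndependent_index (hw : ∀ k : K.Crossing, k.IsLoopIndex (w k)) :
    LinearIndependent ℤ fun (k : K.Crossing) (U : K.BoundedRegion) => w k U.point := by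
  classical
  rw [Fintype.linearIndependent_iff]
  intro a ha
  refine LongPlaneCurve.eq_zero_of_combination_eq_zero hw fun z hz => ?_
  obtain ⟨U, hU, hzU⟩ := exists_isRegion_mem hz
  by_cases hb : Bornology.IsBounded U
  · let V : K.BoundedRegion := ⟨U, hU, hb⟩
    have h : ∑ k, a k * w k V.point = 0 := by
      have := congrFun ha V
      rwa [Finset.sum_apply] at this
    rw [← h]
    refine Finset.sum_congr rfl fun k _ => ?_
    rw [hU.apply_eq (hw k).locConst hzU V.point_mem]
  · exact Finset.sum_eq_zero fun k _ => by
      rw [hU.apply_eq_zero hb (hw k).locConst (hw k).vanishesFar hzU, mul_zero]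

end Indices

/-- There are as many bounded regions as crossings. -/
theorem nonempty_equiv_boundedRegion {n : ℕ} (c : Fin n ≃ K.Crossing) :
    Nonempty (Fin n ≃ K.BoundedRegion) := by
  classical
  let _ : Fintype K.Crossing := Fintype.ofEquiv _ c
  choose w hw using fun k : K.Crossing => k.exists_isLoopIndex
  obtain ⟨v, hv⟩ := exists_indicator_eq hw
  have h1 := linearIndependent_indicator_coeff hv
  have : Finite K.BoundedRegion := h1.finite
  let _ : Fintype K.BoundedRegion := Fintype.ofFinite _
  have h2 := h1.fintype_card_le_finrank
  have h3 := (linearIndependent_index hw).fintype_card_le_finrank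
  rw [Module.finrank_fintype_fun_eq_card] at h2 h3
  have h4 : Fintype.card K.Crossing = n := by
    rw [← Fintype.card_congr c, Fintype.card_fin]
  exact ⟨(Fintype.equivFinOfCardEq (by omega)).symm⟩

/-! ### Alexander's matrix and the indices -/

/-- The value at a corner, given by its directions along the over and under strand, of a function
with the quadrant values `q`. -/
def cornerValue (k : K.Crossing) (q : ℤˣ → ℤˣ → ℤ) (a b : ℤˣ) : ℤ :=
  if K.overFirst k then q a b else q b a

theorem cornerVector_eq (k : K.Crossing) (a b : ℤˣ) :
    ((a : ℤ) : ℂ) * overDir k + ((b : ℤ) : ℂ) * underDir k =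
      if K.overFirst k then
        ((a : ℤ) : ℂ) * deriv K.γ k.first + ((b : ℤ) : ℂ) * deriv K.γ k.second
      else ((b : ℤ) : ℂ) * deriv K.γ k.first + ((a : ℤ) : ℂ) * deriv K.γ k.second := by
  unfold overDir underDir overTime underTime
  split_ifs
  · rfl
  · rw [add_comm]

theorem eventually_corner_eq (k : K.Crossing) {g : ℂ → ℤ} {q : ℤˣ → ℤˣ → ℤ}
    (hq : k.QuadrantValues g q) (a b : ℤˣ) :
    ∀ᶠ δ : ℝ in 𝓝[>] 0, g (K.γ k.first + (δ : ℂ) * (((a : ℤ) : ℂ) * overDir k +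
      ((b : ℤ) : ℂ) * underDir k)) = cornerValue k q a b := by
  rw [cornerVector_eq]
  unfold cornerValue
  split_ifs
  · exact hq.ray a b
  · exact hq.ray b a

theorem eventually_corner_mem_offCurve (k : K.Crossing) (a b : ℤˣ) :
    ∀ᶠ δ : ℝ in 𝓝[>] 0, K.γ k.first + (δ : ℂ) * (((a : ℤ) : ℂ) * overDir k +
      ((b : ℤ) : ℂ) * underDir k) ∈ K.toLongPlaneCurve.offCurve := by
  have key : ∀ a b : ℤˣ, ∀ᶠ δ : ℝ in 𝓝[>] 0, K.γ k.first + δ * (((a : ℤ) : ℂ) *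
      deriv K.γ k.first + ((b : ℤ) : ℂ) * deriv K.γ k.second) ∈ K.toLongPlaneCurve.offCurve := by
    intro a b
    obtain ⟨e⟩ := k.nonempty_chart
    have hx := e.swap.eventually_ray b a
    simp only [add_comm (((b : ℤ) : ℂ) * deriv K.γ k.second)] at hx
    have hline : Filter.Tendsto (fun δ : ℝ => K.γ k.first + δ * (((a : ℤ) : ℂ) *
        deriv K.γ k.first + ((b : ℤ) : ℂ) * deriv K.γ k.second)) (𝓝[>] 0) (𝓝 (K.γ k.first)) := by
      have : Continuous (fun δ : ℝ => K.γ k.first + δ * (((a : ℤ) : ℂ) *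
        deriv K.γ k.first + ((b : ℤ) : ℂ) * deriv K.γ k.second)) := by fun_prop
      have h := this.tendsto 0
      simp only [Complex.ofReal_zero, zero_mul, add_zero] at h
      exact h.mono_left nhdsWithin_le_nhds
    filter_upwards [hx, e.eventually_ray a b,
      hline.eventually (LongPlaneCurve.Crossing.eventually_mem_offCurve e)] with δ h1 h2 h3
    refine h3 (fun h => ?_) (fun h => ?_)
    · rw [show e.swap.y _ = e.x _ from rfl, h] at h1
      simp at h1
    · rw [h] at h2
      simp at h2
  rw [cornerVector_eq]
  split_ifs
  · exact key a b
  · exact key b a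

/-- Each corner lies in exactly one region, namely that of the points on the ray into it. -/
theorem exists_region_corner (k : K.Crossing) (a b : ℤˣ) :
    ∃ U, K.IsRegion U ∧ CornerIn k a b U := by
  obtain ⟨δ₀, hδ₀, h⟩ := mem_nhdsGT_iff_exists_Ioo_subset.1 (eventually_corner_mem_offCurve k a b)
  have hδ₀' : (0 : ℝ) < δ₀ := hδ₀
  set f : ℝ → ℂ := fun δ => K.γ k.first + (δ : ℂ) * (((a : ℤ) : ℂ) * overDir k +
    ((b : ℤ) : ℂ) * underDir k) with hf
  have hpre : IsPreconnected (f '' Set.Ioo 0 δ₀) :=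
    isPreconnected_Ioo.image _ (Continuous.continuousOn (by fun_prop))
  have hsub : f '' Set.Ioo 0 δ₀ ⊆ K.complement := by
    rintro _ ⟨δ, hδ, rfl⟩
    exact h hδ
  have hmem : f (δ₀ / 2) ∈ f '' Set.Ioo 0 δ₀ := ⟨_, ⟨by linarith, by linarith⟩, rfl⟩
  refine ⟨_, ⟨f (δ₀ / 2), hsub hmem, rfl⟩, ?_⟩
  filter_upwards [Ioo_mem_nhdsGT hδ₀'] with δ hδ
  exact hpre.subset_connectedComponentIn hmem hsub ⟨δ, hδ, rfl⟩

open Classical in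
/-- The value at a corner of a function vanishing on the unbounded regions, read off from its values
on the bounded regions. -/
theorem sum_corner {n : ℕ} (r : Fin n ≃ K.BoundedRegion) (k : K.Crossing) {g : ℂ → ℤ}
    (hg : K.toLongPlaneCurve.LocConst g) (hfar : K.toLongPlaneCurve.VanishesFar g)
    {q : ℤˣ → ℤˣ → ℤ} (hq : k.QuadrantValues g q) (a b : ℤˣ) :
    ∑ j, (if CornerIn k a b (r j).1 then g (r j).point else 0) = cornerValue k q a b := by
  obtain ⟨U, hU, hcU⟩ := exists_region_corner k a b
  obtain ⟨δ, h1, h2⟩ := (Filter.Eventually.and hcU (eventually_corner_eq k hq a b)).exists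
  have hiff : ∀ j, CornerIn k a b (r j).1 ↔ (r j).1 = U := fun j => by
    constructor
    · intro h
      obtain ⟨δ', h3, h4⟩ := (Filter.Eventually.and h hcU).exists
      exact (r j).2.1.eq_of_mem hU h3 h4
    · rintro h
      rwa [h]
  simp only [hiff]
  by_cases hb : Bornology.IsBounded U
  · obtain ⟨j, hj⟩ := r.surjective ⟨U, hU, hb⟩
    have hj' : (r j).1 = U := by rw [hj]
    rw [Finset.sum_eq_single j]
    · rw [if_pos hj', ← h2]
      exact hU.apply_eq hg (hj' ▸ (r j).point_mem) h1
    · intro i _ hij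
      refine if_neg fun h => hij (r.injective (Subtype.ext (h.trans hj'.symm)))
    · simp
  · rw [Finset.sum_eq_zero, ← h2, hU.apply_eq_zero hb hg hfar h1]
    intro j _
    refine if_neg fun h => hb ?_
    rw [← h]
    exact (r j).2.2

theorem crossingSign_eq (k : K.Crossing) :
    crossingSign k = if K.overFirst k then (k.orientation : ℤ) else -k.orientation := by
  have hne := k.cross_ne_zero
  have h : crossingSign k = if 0 < cross (overDir k) (underDir k) then 1 else -1 := rfl
  rw [h]
  unfold overDir underDir overTime underTime LongPlaneCurve.Crossing.orientation
    LongPlaneCurve.signUnit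
  by_cases ho : K.overFirst k
  · simp only [ho, if_true]
    split_ifs <;> simp
  · simp only [if_neg ho]
    rw [cross_swap]
    rcases lt_or_gt_of_ne hne with h1 | h1
    · simp [h1, h1.not_gt]
    · simp [h1, h1.le]

open Classical in
/-- The sum of the index of a loop over the marked corners at a crossing. The two markings
on each side of the over strand add up to zero, so only the jumps across the under strand
contribute; at the crossing of the loop itself the loop turns a corner, which yields the additional term. -/
theorem sum_marking_cornerValue (l k : K.Crossing) {g : ℂ → ℤ} (hg : l.IsLoopIndex g)
    [Finite K.Crossing] {q : ℤˣ → ℤˣ → ℤ} (hq : k.QuadrantValues g q) :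
    ∑ a : ℤˣ, ∑ b : ℤˣ, marking k a b * (cornerValue k q a b : ℤ[X]) =
      (crossingSign k : ℤ[X]) * (1 - Polynomial.X) * (l.spanIndicator (underTime k) : ℤ[X]) +
        if l = k then (if S k = 1 then -(crossingSign k : ℤ[X]) * Polynomial.X
          else (crossingSign k : ℤ[X])) else 0 := by
  have h1 : ∀ a : ℤˣ, q a k.orientation - q a (-k.orientation) =
      l.spanIndicator k.first + if l = k ∧ a = 1 then 1 else 0 := fun a => by
    obtain ⟨s, hs, hs1, hs2, hs3⟩ := K.toLongPlaneCurve.exists_isSimpleTime a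
      ((hq.jump_first a).and (l.eventually_spanIndicator_first k a))
    rw [← hs3 hs]
    exact (hs2 hs).unique (hg.hasJump s hs1)
  have h2 : ∀ b : ℤˣ, q (-k.orientation) b - q k.orientation b =
      l.spanIndicator k.second + if l = k ∧ b = -1 then 1 else 0 := fun b => by
    obtain ⟨s, hs, hs1, hs2, hs3⟩ := K.toLongPlaneCurve.exists_isSimpleTime b
      ((hq.jump_second b).and (l.eventually_spanIndicator_second k b))
    rw [← hs3 hs]
    exact (hs2 hs).unique (hg.hasJump s hs1)
  have h1' := fun a => congrArg (Int.cast : ℤ → ℤ[X]) (h1 a)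
  have h2' := fun b => congrArg (Int.cast : ℤ → ℤ[X]) (h2 b)
  have e1 := h1' 1
  have e2 := h1' (-1)
  have e3 := h2' 1
  have e4 := h2' (-1)
  have hu : (Finset.univ : Finset ℤˣ) = {1, -1} := rfl
  have hne : (1 : ℤˣ) ∉ ({-1} : Finset ℤˣ) := by decide
  simp only [hu, Finset.sum_insert hne, Finset.sum_singleton, marking, S, direction,
    crossingSign_eq, cornerValue, underTime]
  clear h1 h2 h1' h2' hq hg
  by_cases ho : K.overFirst k <;> by_cases hlk : l = k <;>
    rcases Int.units_eq_one_or k.orientation with hk | hk <;>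
    rw [hk] at e1 e2 e3 e4 <;> simp [ho, hlk, hk] at e1 e2 e3 e4 ⊢
  · linear_combination e3 - Polynomial.X * e4
  · linear_combination Polynomial.X * e3 - e4
  · linear_combination e3 - Polynomial.X * e4
  · linear_combination Polynomial.X * e3 - e4
  · linear_combination Polynomial.X * e1 - e2
  · linear_combination e1 - Polynomial.X * e2
  · linear_combination Polynomial.X * e1 - e2
  · linear_combination e1 - Polynomial.X * e2

end LongKnotDiagram

namespace LongKnotDiagram

variable {K : LongKnotDiagram} {n : ℕ}

/-! ### The comparison of determinants -/

/-- The indices of the loops at the crossings around the bounded regions. -/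
noncomputable def indexMatrix (w : K.Crossing → ℂ → ℤ) (c : Fin n ≃ K.Crossing)
    (r : Fin n ≃ K.BoundedRegion) : Matrix (Fin n) (Fin n) ℤ :=
  Matrix.of fun j k => w (c k) (r j).point

/-- The index matrix is unimodular, since the indicator functions of the bounded regions are
integral combinations of the indices of the loops. -/
theorem isUnit_det_indexMatrix {w : K.Crossing → ℂ → ℤ}
    (hw : ∀ k : K.Crossing, k.IsLoopIndex (w k)) (c : Fin n ≃ K.Crossing)
    (r : Fin n ≃ K.BoundedRegion) : IsUnit (K.indexMatrix w c r).det := by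
  classical
  let _ : Fintype K.Crossing := Fintype.ofEquiv _ c
  obtain ⟨v, hv⟩ := exists_indicator_eq hw
  refine Matrix.isUnit_det_of_right_inverse
    (B := Matrix.of fun k j => v (r j) (c k)) ?_
  ext i j
  simp only [Matrix.mul_apply, indexMatrix, Matrix.of_apply]
  have h := hv (r j) _ (r i).point_mem_offCurve
  rw [BoundedRegion.indicator_point, ← c.sum_comp] at h
  simp only [Matrix.one_apply, mul_comm (w _ _)]
  rw [← h]
  simp only [r.injective.eq_iff, eq_comm]

open Classical in
/-- The entries of Alexander's matrix in the basis given by the indices of the loops. -/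
theorem alexanderMatrix_mul_indexMatrix {w : K.Crossing → ℂ → ℤ}
    (hw : ∀ k : K.Crossing, k.IsLoopIndex (w k)) (c : Fin n ≃ K.Crossing)
    (r : Fin n ≃ K.BoundedRegion) (i k : Fin n) :
    (K.alexanderMatrix c r * (K.indexMatrix w c r).map (Int.cast : ℤ → ℤ[X])) i k =
      (crossingSign (c i) : ℤ[X]) * (1 - Polynomial.X) *
        ((c k).spanIndicator (underTime (c i)) : ℤ[X]) +
        if c k = c i then (if S (c i) = 1 then -(crossingSign (c i) : ℤ[X]) * Polynomial.X
          else (crossingSign (c i) : ℤ[X])) else 0 := by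
  have : Finite K.Crossing := Finite.of_equiv _ c
  obtain ⟨q, hq⟩ := (c i).exists_quadrantValues ((hw (c k)).locConst.near _)
  rw [← sum_marking_cornerValue (c k) (c i) (hw (c k)) hq]
  simp only [Matrix.mul_apply, alexanderMatrix, Matrix.of_apply, Matrix.map_apply, indexMatrix,
    Finset.sum_mul]
  rw [Finset.sum_comm]
  refine Finset.sum_congr rfl fun a _ => ?_
  rw [Finset.sum_comm]
  refine Finset.sum_congr rfl fun b _ => ?_
  rw [← sum_corner r (c i) (hw (c k)).locConst (hw (c k)).vanishesFar hq a b, Int.cast_sum,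
    Finset.mul_sum]
  refine Finset.sum_congr rfl fun j _ => ?_
  split_ifs <;> simp

theorem S_eq (k : K.Crossing) : S k = 1 ∨ S k = -1 := by
  unfold S crossingSign direction
  split_ifs <;> simp

/-- The factors of the rows of Alexander's matrix, in the basis given by the indices of the loops,
that do not occur in the matrix defining `β`. -/
noncomputable def rowFactor (k : K.Crossing) : ℤ[T;T⁻¹] :=
  if S k = 1 then -(crossingSign k : ℤ[T;T⁻¹]) * LaurentPolynomial.T 1 else crossingSign k

theorem exists_rowFactor_eq (k : K.Crossing) : ∃ e : ℤˣ, rowFactor k =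
    ((e : ℤ) : ℤ[T;T⁻¹]) * LaurentPolynomial.T (if S k = 1 then 1 else 0) := by
  unfold rowFactor crossingSign
  by_cases hS : S k = 1
  · simp only [if_pos hS]
    split_ifs
    · exact ⟨-1, by simp⟩
    · exact ⟨1, by simp⟩
  · simp only [if_neg hS]
    split_ifs
    · exact ⟨1, by simp⟩
    · exact ⟨-1, by simp⟩

theorem exists_prod_rowFactor_eq (c : Fin n ≃ K.Crossing) : ∃ e : ℤˣ, ∏ i, rowFactor (c i) =
    ((e : ℤ) : ℤ[T;T⁻¹]) * LaurentPolynomial.T (K.numPositiveS : ℤ) := by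
  classical
  choose e he using fun i => exists_rowFactor_eq (c i)
  refine ⟨∏ i, e i, ?_⟩
  have hT : ∀ f : Fin n → ℤ, ∏ i, (LaurentPolynomial.T (f i) : ℤ[T;T⁻¹]) =
      LaurentPolynomial.T (∑ i, f i) := fun f => by
    induction (Finset.univ : Finset (Fin n)) using Finset.induction_on with
    | empty => simp
    | insert a s ha ih => rw [Finset.prod_insert ha, Finset.sum_insert ha, ih,
        LaurentPolynomial.T_add]
  have hcard : (K.numPositiveS : ℤ) = ∑ i, if S (c i) = 1 then 1 else 0 := by
    have h : K.numPositiveS = Nat.card {i // S (c i) = 1} :=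
      (Nat.card_congr (c.subtypeEquiv fun _ => Iff.rfl)).symm
    rw [h, Nat.card_eq_fintype_card, Fintype.card_subtype, Finset.sum_boole]
  simp only [he]
  rw [Finset.prod_mul_distrib, hT, ← hcard, Units.coe_prod, Int.cast_prod]

/-- In the basis given by the indices of the loops, Alexander's matrix is the transpose of the
matrix defining `β`, up to the row factors. -/
theorem map_alexanderMatrix_mul_indexMatrix {w : K.Crossing → ℂ → ℤ}
    (hw : ∀ k : K.Crossing, k.IsLoopIndex (w k)) (c : Fin n ≃ K.Crossing)
    (r : Fin n ≃ K.BoundedRegion) :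
    (K.alexanderMatrix c r * (K.indexMatrix w c r).map (Int.cast : ℤ → ℤ[X])).map
        Polynomial.toLaurent =
      Matrix.diagonal (fun i => rowFactor (c i)) *
        (1 + K.trappingMatrix c * (1 - K.xPowNegS c)).transpose := by
  classical
  ext1 i k
  have hdiag : (1 - K.xPowNegS c : Matrix (Fin n) (Fin n) ℤ[T;T⁻¹]) =
      Matrix.diagonal fun i => 1 - LaurentPolynomial.T (-S (c i)) := by
    rw [xPowNegS, ← Matrix.diagonal_one, Matrix.diagonal_sub]
  have hT : (K.trappingMatrix c k i : ℤ[T;T⁻¹]) =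
      (((c k).spanIndicator (underTime (c i)) : ℤ) : ℤ[T;T⁻¹]) := by
    by_cases h : underTime (c i) ∈ spanTimes (c k)
    · simp only [trappingMatrix, Matrix.of_apply, if_pos h, LongPlaneCurve.Crossing.spanIndicator,
        if_pos (show underTime (c i) ∈ Set.Ioo (c k).first (c k).second from h), Int.cast_one]
    · simp only [trappingMatrix, Matrix.of_apply, if_neg h, LongPlaneCurve.Crossing.spanIndicator,
        if_neg (show underTime (c i) ∉ Set.Ioo (c k).first (c k).second from h), Int.cast_zero]
  rw [Matrix.map_apply, alexanderMatrix_mul_indexMatrix hw, Matrix.diagonal_mul,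
    Matrix.transpose_apply, Matrix.add_apply, hdiag, Matrix.mul_diagonal, hT, Matrix.one_apply]
  have hinv : (LaurentPolynomial.T 1 : ℤ[T;T⁻¹]) * LaurentPolynomial.T (-1) = 1 := by
    rw [← LaurentPolynomial.T_add]; simp
  have hki : c k = c i ↔ k = i := c.injective.eq_iff
  simp only [hki, rowFactor, map_add, map_mul, map_sub, map_intCast, map_one,
    Polynomial.toLaurent_X]
  rcases S_eq (c i) with h | h
  · by_cases hk : k = i
    · simp only [h, hk, if_true, map_mul, map_neg, map_intCast, Polynomial.toLaurent_X]
      linear_combination (-(crossingSign (c i) : ℤ[T;T⁻¹]) *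
        ((c i).spanIndicator (underTime (c i)) : ℤ[T;T⁻¹])) * hinv
    · simp only [h, hk, if_true, if_false, map_zero]
      linear_combination (-(crossingSign (c i) : ℤ[T;T⁻¹]) *
        ((c k).spanIndicator (underTime (c i)) : ℤ[T;T⁻¹])) * hinv
  · have h1 : ¬ (-1 : ℤ) = 1 := by decide
    by_cases hk : k = i
    · simp only [h, hk, h1, if_true, if_false, map_intCast, neg_neg]
      ring
    · simp only [h, hk, h1, if_false, map_zero, neg_neg]
      ring

end LongKnotDiagram

theorem mainTheorem1 (K : LongKnotDiagram) (n : ℕ) (c : Fin n ≃ K.Crossing) :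
    Nonempty (Fin n ≃ K.BoundedRegion) ∧
    ∀ r : Fin n ≃ K.BoundedRegion,
      K.beta c =
          LaurentPolynomial.T (-(K.numPositiveS : ℤ)) * Polynomial.toLaurent (K.alexanderDet c r) ∨
      K.beta c =
          -(LaurentPolynomial.T (-(K.numPositiveS : ℤ)) *
            Polynomial.toLaurent (K.alexanderDet c r)) := by
  refine ⟨LongKnotDiagram.nonempty_equiv_boundedRegion c, fun r => ?_⟩
  have : Finite K.Crossing := Finite.of_equiv _ c
  choose w hw using fun k : K.Crossing => k.exists_isLoopIndex
  have hdet := congrArg Matrix.det (LongKnotDiagram.map_alexanderMatrix_mul_indexMatrix hw c r)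
  rw [← RingHom.mapMatrix_apply, ← RingHom.map_det, Matrix.det_mul, Matrix.det_mul,
    Matrix.det_diagonal, Matrix.det_transpose, map_mul] at hdet
  have hW : ((K.indexMatrix w c r).map (Int.cast : ℤ → ℤ[X])).det =
      (((K.indexMatrix w c r).det : ℤ) : ℤ[X]) :=
    (RingHom.map_det (Int.castRingHom ℤ[X]) (K.indexMatrix w c r)).symm
  obtain ⟨e, he⟩ := LongKnotDiagram.exists_prod_rowFactor_eq c
  obtain ⟨u, hu⟩ := LongKnotDiagram.isUnit_det_indexMatrix hw c r
  have hinv : (LaurentPolynomial.T (-(K.numPositiveS : ℤ)) : ℤ[T;T⁻¹]) *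
      LaurentPolynomial.T (K.numPositiveS : ℤ) = 1 := by
    rw [← LaurentPolynomial.T_add]; simp
  change Polynomial.toLaurent (K.alexanderDet c r) * _ = _ * K.beta c at hdet
  rw [hW, ← hu, he, map_intCast] at hdet
  rcases Int.units_eq_one_or e with rfl | rfl <;> rcases Int.units_eq_one_or u with rfl | rfl <;>
    simp only [Units.val_one, Units.val_neg, Int.cast_one, Int.cast_neg] at hdet
  · left
    linear_combination -LaurentPolynomial.T (-(K.numPositiveS : ℤ)) * hdet - K.beta c * hinv
  · right
    linear_combination -LaurentPolynomial.T (-(K.numPositiveS : ℤ)) * hdet - K.beta c * hinv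
  · right
    linear_combination LaurentPolynomial.T (-(K.numPositiveS : ℤ)) * hdet - K.beta c * hinv
  · left
    linear_combination LaurentPolynomial.T (-(K.numPositiveS : ℤ)) * hdet - K.beta c * hinv
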